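/- Let $[n]=\{1,\dots,n\}$ and $\lg=\log_2$. A down step of a permutation $\pi$ of $[n]$ is a position $i<n$ with $\pi(i+1)<\pi(i)$; if $\pi$ has $k$ down steps, then $\rho=\rho(\pi)=k+1$ is its number of (ascending) runs. There is an encoding scheme that represents every permutation $\pi$ of $[n]$, $n\ge 1$, by a string of at most $$n\lceil \lg\rho\rceil\,(1+o(1)) + O(\log n)$$ bits and that supports both $\pi(i)$ and $\pi^{-1}(i)$ in worst-case time $O(1+\log\rho)$ for every $i\in[n]$. Here the term $o(1)$ is a function of $n$ alone that tends to $0$ as $n\to\infty$ (uniformly over all permutations of $[n]$, hence over all $\rho$), $O(\log n)$ is read as $O(\log(n+1))$ when $n=1$, and the constants hidden in the $O$-terms are absolute. The machine is the word RAM with word length $w\ge c\lg(n+1)$ for an absolute constant $c$ (every such $w$ is allowed, and the encoding does not depend on $w$): the encoding is stored in a read-only memory, $w$ bits per word; the usual arithmetic, bitwise, shift, comparison, load, store and control operations on $w$-bit words take unit time; and each of the two queries is answered by one fixed program, which gets only $i$ and access to the encoding, together with a working memory that is initially zero. -/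

import Mathlib

namespace SuccinctPerm

/-! ### Runs of a permutation -/

/-- The down steps of `π`: the positions `i` that have a successor and satisfy `π (i+1) < π i`. -/
def downSteps {n : ℕ} (π : Equiv.Perm (Fin n)) : Finset (Fin n) :=
  Finset.univ.filter fun i => ∃ h : (i : ℕ) + 1 < n, π ⟨(i : ℕ) + 1, h⟩ < π i

/-- The number of (ascending) runs of `π`, which is one more than the number of down steps. -/
def numRuns {n : ℕ} (π : Equiv.Perm (Fin n)) : ℕ :=
  (downSteps π).card + 1

/-! ### The word RAM

A machine with word length `w` has registers and a working memory that hold `w`-bit words, and a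
read-only data memory in which the bit string that represents the data structure is stored,
`w` consecutive bits per word. Every instruction takes unit time. A program is a fixed finite
object: it depends on neither the data nor the word length. -/

/-- The binary operations on words. -/
inductive WordOp where
  | add | sub | mul | div | mod | and | or | xor | shl | shr | eq | lt

/-- Arithmetic is unsigned and modulo `2 ^ w`; a comparison returns `1` or `0`. -/
def WordOp.eval {w : ℕ} : WordOp → BitVec w → BitVec w → BitVec w
  | .add, x, y => x + y
  | .sub, x, y => x - y
  | .mul, x, y => x * y
  | .div, x, y => x / y
  | .mod, x, y => x % y
  | .and, x, y => x &&& y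
  | .or, x, y => x ||| y
  | .xor, x, y => x ^^^ y
  | .shl, x, y => x <<< y.toNat
  | .shr, x, y => x >>> y.toNat
  | .eq, x, y => if x = y then 1#w else 0#w
  | .lt, x, y => if x.toNat < y.toNat then 1#w else 0#w

/-- Programs of the word RAM. Registers are numbered by natural numbers, and every program
mentions only finitely many of them. -/
inductive Program where
  /-- do nothing -/
  | skip
  /-- `reg d := c` (modulo `2 ^ w`) -/
  | const (d c : ℕ)
  /-- `reg d := w` -/
  | wordLength (d : ℕ)
  /-- `reg d := o (reg a) (reg b)` -/
  | op (o : WordOp) (d a b : ℕ)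
  /-- `reg d := data[reg a]` -/
  | loadData (d a : ℕ)
  /-- `reg d := mem[reg a]` -/
  | load (d a : ℕ)
  /-- `mem[reg a] := reg b` -/
  | store (a b : ℕ)
  /-- first `p`, then `q` -/
  | seq (p q : Program)
  /-- `p` if `reg r ≠ 0`, and `q` otherwise -/
  | ite (r : ℕ) (p q : Program)
  /-- repeat `p` as long as `reg r ≠ 0` -/
  | loop (r : ℕ) (p : Program)

/-- The state of a machine: registers and working memory. -/
structure State (w : ℕ) where
  reg : ℕ → BitVec w
  mem : BitVec w → BitVec w

/-- Write the word `x` into register `d`. -/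
def State.setReg {w : ℕ} (s : State w) (d : ℕ) (x : BitVec w) : State w :=
  { s with reg := Function.update s.reg d x }

/-- Write the word `x` into cell `a` of the working memory. -/
def State.setMem {w : ℕ} (s : State w) (a x : BitVec w) : State w :=
  { s with mem := Function.update s.mem a x }

/-- At the start, register `0` holds the input; everything else is zero. -/
def State.init (w input : ℕ) : State w where
  reg := Function.update (fun _ => 0#w) 0 (BitVec.ofNat w input)
  mem := fun _ => 0#w

/-- The data memory that stores the bit string `bits`: bit `k < w` (least significant first) of the
word at address `j` is bit `j * w + k` of the string, and bits beyond its end are `0`. -/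
def dataWord (w : ℕ) (bits : List Bool) (j : BitVec w) : BitVec w :=
  BitVec.ofFnLE fun k : Fin w => bits.getD (j.toNat * w + k) false

/-- `Exec data p s s' t`: with data memory `data`, the program `p` started in state `s` halts in
state `s'` after exactly `t` time units. -/
inductive Exec {w : ℕ} (data : BitVec w → BitVec w) :
    Program → State w → State w → ℕ → Prop where
  | skip (s : State w) : Exec data .skip s s 1
  | const (s : State w) (d c : ℕ) :
      Exec data (.const d c) s (s.setReg d (BitVec.ofNat w c)) 1
  | wordLength (s : State w) (d : ℕ) :
      Exec data (.wordLength d) s (s.setReg d (BitVec.ofNat w w)) 1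
  | op (s : State w) (o : WordOp) (d a b : ℕ) :
      Exec data (.op o d a b) s (s.setReg d (o.eval (s.reg a) (s.reg b))) 1
  | loadData (s : State w) (d a : ℕ) :
      Exec data (.loadData d a) s (s.setReg d (data (s.reg a))) 1
  | load (s : State w) (d a : ℕ) :
      Exec data (.load d a) s (s.setReg d (s.mem (s.reg a))) 1
  | store (s : State w) (a b : ℕ) :
      Exec data (.store a b) s (s.setMem (s.reg a) (s.reg b)) 1
  | seq {p q : Program} {s s' s'' : State w} {t t' : ℕ} :
      Exec data p s s' t → Exec data q s' s'' t' → Exec data (.seq p q) s s'' (t + t')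
  | iteTrue {r : ℕ} {p q : Program} {s s' : State w} {t : ℕ} :
      s.reg r ≠ 0#w → Exec data p s s' t → Exec data (.ite r p q) s s' (t + 1)
  | iteFalse {r : ℕ} {p q : Program} {s s' : State w} {t : ℕ} :
      s.reg r = 0#w → Exec data q s s' t → Exec data (.ite r p q) s s' (t + 1)
  | loopDone {r : ℕ} {p : Program} {s : State w} :
      s.reg r = 0#w → Exec data (.loop r p) s s 1
  | loopStep {r : ℕ} {p : Program} {s s' s'' : State w} {t t' : ℕ} :
      s.reg r ≠ 0#w → Exec data p s s' t → Exec data (.loop r p) s' s'' t' →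
        Exec data (.loop r p) s s'' (t + t' + 1)

/-- On a word RAM with word length `w` whose data memory stores `bits`, the program `p` with the
given input halts within time `T` and leaves the given output in register `0`. -/
def AnswersWithin (w : ℕ) (bits : List Bool) (p : Program) (input output : ℕ) (T : ℝ) : Prop :=
  ∃ (s : State w) (t : ℕ), Exec (dataWord w bits) p (State.init w input) s t ∧
    (s.reg 0).toNat = output ∧ (t : ℝ) ≤ T

end SuccinctPerm

open SuccinctPerm

/-! Give each value `v` the number of the run that contains its position `π⁻¹ v`. Within a run
values increase with position, so sorting the values stably by run number recovers the order of
positions: the rank of `v` after the sort is `π⁻¹ v` (`pos_runIndex`). Do this sort as a binary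
radix sort with `h = ⌈lg ρ⌉` stable partitions, least significant bit first. Round `j` is described
by a vector of `n` bits, namely bit `j` of the key at each current position. One round maps a
position forward by a rank query (`pos_succ`) and is undone by a select query (`pos_eq_query`).
Following all rounds forward computes `π⁻¹`, backward `π`, so with constant time rank and select
both take `O(1 + h)` time.

Rank and the two selects are treated alike, as monotone functions `f` with `f k ≤ n + k`. Arguments
are cut into superblocks of length `b ^ 3` and blocks of length `b`. Where `f` grows by much more
than the length (more than `b ^ 6`, respectively `b ^ 2`), all values are stored explicitly;
monotonicity makes such places rare (`count_sparse_mul_le`). In a dense superblock relative values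
need only `O(log b)` bits, and in a dense block the answer is determined by a window of `b ^ 2`
bits, looked up in a table over all windows. With `b` about `√(lg n / 2)` the table has `√n` windows
up to a constant factor, and everything besides the `n` raw bits is `o(n)` (`total_params_le_add`,
`tendsto_redundancy`). The correctness of the lookup is `run_queryCode`.

To run this on the word RAM, programs are compiled from arithmetic expressions on natural numbers.
With `P = 2 ^ lam`, a static check bounds all intermediate values by `P ^ 16`, so nothing overflows
once `16 * lam < w` (`Expr.computes_compile`). The encoding must not depend on `w`, so fields
straddle word boundaries (`unaligned_read`), and the program must find `lam` by itself: the first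
field is a block of ones below a zero, which arithmetic on the first word detects (`first_word`). -/

namespace SuccinctPerm

/-! ### Running programs with a time bound -/

/-- `p` started in `s` halts within `T` steps in a state that satisfies `Q`. -/
def Computes {w : ℕ} (data : BitVec w → BitVec w) (p : Program) (s : State w) (T : ℕ)
    (Q : State w → Prop) : Prop :=
  ∃ s' t, Exec data p s s' t ∧ t ≤ T ∧ Q s'

section Computes

variable {w : ℕ} {data : BitVec w → BitVec w} {p q : Program} {s : State w} {T T' : ℕ}
  {Q R : State w → Prop}

theorem Computes.mono (h : Computes data p s T Q) (hT : T ≤ T') (hQ : ∀ s', Q s' → R s') :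
    Computes data p s T' R := by
  obtain ⟨s', t, h1, h2, h3⟩ := h
  exact ⟨s', t, h1, h2.trans hT, hQ _ h3⟩

theorem Computes.seq (h : Computes data p s T Q) (h' : ∀ s', Q s' → Computes data q s' T' R) :
    Computes data (.seq p q) s (T + T') R := by
  obtain ⟨s', t, h1, h2, h3⟩ := h
  obtain ⟨s'', t', h1', h2', h3'⟩ := h' s' h3
  exact ⟨s'', _, .seq h1 h1', by omega, h3'⟩

theorem Computes.ite {r : ℕ} (h1 : s.reg r ≠ 0#w → Computes data p s T Q)
    (h2 : s.reg r = 0#w → Computes data q s T' Q) :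
    Computes data (.ite r p q) s (T + T' + 1) Q := by
  by_cases h : s.reg r = 0#w
  · obtain ⟨s', t, h3, h4, h5⟩ := h2 h
    exact ⟨s', _, .iteFalse h h3, by omega, h5⟩
  · obtain ⟨s', t, h3, h4, h5⟩ := h1 h
    exact ⟨s', _, .iteTrue h h3, by omega, h5⟩

theorem Computes.op {o : WordOp} {d a b : ℕ}
    (h : Q (s.setReg d (o.eval (s.reg a) (s.reg b)))) : Computes data (.op o d a b) s 1 Q :=
  ⟨_, _, .op s o d a b, le_rfl, h⟩

theorem Computes.const {d c : ℕ} (h : Q (s.setReg d (BitVec.ofNat w c))) :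
    Computes data (.const d c) s 1 Q :=
  ⟨_, _, .const s d c, le_rfl, h⟩

theorem Computes.wordLength {d : ℕ} (h : Q (s.setReg d (BitVec.ofNat w w))) :
    Computes data (.wordLength d) s 1 Q :=
  ⟨_, _, .wordLength s d, le_rfl, h⟩

theorem Computes.loadData {d a : ℕ} (h : Q (s.setReg d (data (s.reg a)))) :
    Computes data (.loadData d a) s 1 Q :=
  ⟨_, _, .loadData s d a, le_rfl, h⟩

theorem Computes.skip (h : Q s) : Computes data .skip s 1 Q :=
  ⟨_, _, .skip s, le_rfl, h⟩

/-- A loop with an invariant `I k`, where `k` is the number of iterations that are left. -/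
theorem Computes.loop {r : ℕ} {I : ℕ → State w → Prop}
    (h0 : ∀ s, I 0 s → s.reg r = 0#w)
    (hstep : ∀ k s, I (k + 1) s → s.reg r ≠ 0#w ∧ Computes data p s T (I k))
    (k : ℕ) (s : State w) (h : I k s) :
    Computes data (.loop r p) s (k * (T + 1) + 1) (I 0) := by
  induction k generalizing s with
  | zero => exact ⟨s, 1, .loopDone (h0 s h), by omega, h⟩
  | succ k ih =>
    obtain ⟨hr, s', t, h1, h2, h3⟩ := hstep k s h
    obtain ⟨s'', t', h4, h5, h6⟩ := ih s' h3
    exact ⟨s'', _, .loopStep hr h1 h4, by rw [add_mul]; omega, h6⟩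

end Computes

@[simp] theorem State.setReg_reg {w : ℕ} (s : State w) (d : ℕ) (x : BitVec w) (r : ℕ) :
    (s.setReg d x).reg r = if r = d then x else s.reg r := by
  simp [State.setReg, Function.update_apply]

/-! ### Reading a field of consecutive bits -/

/-- The number whose binary digits are the `l` bits of the string from position `p` on. -/
def readBits (bits : List Bool) (p l : ℕ) : ℕ :=
  (BitVec.ofFnLE fun k : Fin l => bits.getD (p + k) false).toNat

theorem testBit_readBits (bits : List Bool) (p l k : ℕ) :
    (readBits bits p l).testBit k = (decide (k < l) && bits.getD (p + k) false) := by
  rw [readBits, BitVec.testBit_toNat, BitVec.getLsbD_ofFnLE]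
  by_cases h : k < l <;> simp [h]

theorem readBits_lt (bits : List Bool) (p l : ℕ) : readBits bits p l < 2 ^ l :=
  BitVec.isLt _

theorem readBits_mod (bits : List Bool) (p : ℕ) {l m : ℕ} (h : l ≤ m) :
    readBits bits p m % 2 ^ l = readBits bits p l := by
  refine Nat.eq_of_testBit_eq fun k => ?_
  rw [Nat.testBit_mod_two_pow, testBit_readBits, testBit_readBits]
  by_cases hk : k < l
  · simp [hk, hk.trans_le h]
  · simp [hk]

theorem readBits_div (bits : List Bool) (p l m : ℕ) :
    readBits bits p (l + m) / 2 ^ l = readBits bits (p + l) m := by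
  refine Nat.eq_of_testBit_eq fun k => ?_
  rw [Nat.testBit_div_two_pow, testBit_readBits, testBit_readBits]
  simp [add_assoc, add_comm l]

/-- `reg d := ` the field of `reg (d+1)` bits at position `reg d`. -/
def readCode (d : ℕ) : Program :=
  .seq (.wordLength (d + 2)) <|
  .seq (.op .div (d + 3) d (d + 2)) <|
  .seq (.op .mod d d (d + 2)) <|
  .seq (.op .sub (d + 2) (d + 2) d) <|
  .seq (.loadData (d + 4) (d + 3)) <|
  .seq (.op .shr d (d + 4) d) <|
  .seq (.const (d + 4) 1) <|
  .seq (.op .add (d + 3) (d + 3) (d + 4)) <|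
  .seq (.loadData (d + 3) (d + 3)) <|
  .seq (.op .shl (d + 3) (d + 3) (d + 2)) <|
  .seq (.op .or d d (d + 3)) <|
  .seq (.op .shl (d + 4) (d + 4) (d + 1))
  (.op .mod d d (d + 4))

/-- A field shorter than a word meets at most two consecutive words: the first is shifted down by `p
% w`, the second up by the complement, and the remainder modulo `2 ^ l` cuts off the rest. For an
aligned position the second shift is by `w` and contributes zero, so no case distinction is needed.
-/
theorem unaligned_read {w : ℕ} (bits : List Bool) (p l q w' : BitVec w) (hl : l.toNat < w)
    (hw : w'.toNat = w) (hq : q.toNat = p.toNat / w + 1) :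
    ((dataWord w bits (p / w') >>> (p % w').toNat |||
      dataWord w bits q <<< (w' - p % w').toNat) %
      (1#w <<< l.toNat)).toNat = readBits bits p.toNat l.toNat := by
  have hw0 : 0 < w := by omega
  have hr : p.toNat % w < w := Nat.mod_lt _ hw0
  have hww : w < 2 ^ w := Nat.lt_two_pow_self
  have h1 : (p % w').toNat = p.toNat % w := by rw [BitVec.toNat_umod, hw]
  have h2 : (w' - p % w').toNat = w - p.toNat % w := by
    rw [BitVec.toNat_sub_of_le, hw, h1]
    rw [BitVec.le_def, h1, hw]; exact hr.le
  have h3 : (1#w <<< l.toNat).toNat = 2 ^ l.toNat := by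
    rw [BitVec.toNat_shiftLeft, BitVec.toNat_ofNat, Nat.mod_eq_of_lt (a := 1) (by omega),
      Nat.shiftLeft_eq, one_mul, Nat.mod_eq_of_lt (Nat.pow_lt_pow_right (by norm_num) hl)]
  rw [BitVec.toNat_umod, h3]
  refine Nat.eq_of_testBit_eq fun k => ?_
  rw [Nat.testBit_mod_two_pow, testBit_readBits]
  by_cases hk : k < l.toNat
  swap
  · simp [hk]
  have hkw : k < w := by omega
  have hp : p.toNat = p.toNat / w * w + p.toNat % w := (Nat.div_add_mod' _ _).symm
  simp only [hk, decide_true, Bool.true_and, BitVec.testBit_toNat, BitVec.getLsbD_or,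
    BitVec.getLsbD_ushiftRight, BitVec.getLsbD_shiftLeft, h1, h2, dataWord,
    BitVec.getLsbD_ofFnLE, BitVec.toNat_udiv, hw, hq, hkw]
  by_cases hc : p.toNat % w + k < w
  · rw [dif_pos hc, decide_eq_true (show k < w - p.toNat % w by omega)]
    simp only [Bool.not_true, Bool.false_and, Bool.or_false]
    congr 1
    omega
  · rw [dif_neg hc, decide_eq_false (show ¬ k < w - p.toNat % w by omega), dif_pos (by omega)]
    simp only [Bool.not_false, Bool.true_and, Bool.false_or]
    congr 1
    rw [add_mul]
    omega

theorem computes_readCode {w : ℕ} (bits : List Bool) (s : State w) (d : ℕ)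
    (hw : 2 ≤ w) (hl : (s.reg (d + 1)).toNat < w) :
    Computes (dataWord w bits) (readCode d) s 13 fun s' =>
      (s'.reg d).toNat = readBits bits (s.reg d).toNat (s.reg (d + 1)).toNat ∧
      ∀ r < d, s'.reg r = s.reg r := by
  refine Computes.mono (T := 1+(1+(1+(1+(1+(1+(1+(1+(1+(1+(1+(1+1))))))))))))
    (Q := fun s' => (s'.reg d).toNat = readBits bits (s.reg d).toNat (s.reg (d + 1)).toNat ∧
      ∀ r < d, s'.reg r = s.reg r) ?_ (by norm_num) fun _ h => h
  -- Each `rfl` makes the intermediate assertion "equal to this explicit state", so the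
  -- straight-line code is executed symbolically.
  refine .seq (.wordLength rfl) ?_; rintro _ rfl
  refine .seq (.op rfl) ?_; rintro _ rfl
  refine .seq (.op rfl) ?_; rintro _ rfl
  refine .seq (.op rfl) ?_; rintro _ rfl
  refine .seq (.loadData rfl) ?_; rintro _ rfl
  refine .seq (.op rfl) ?_; rintro _ rfl
  refine .seq (.const rfl) ?_; rintro _ rfl
  refine .seq (.op rfl) ?_; rintro _ rfl
  refine .seq (.loadData rfl) ?_; rintro _ rfl
  refine .seq (.op rfl) ?_; rintro _ rfl
  refine .seq (.op rfl) ?_; rintro _ rfl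
  refine .seq (.op rfl) ?_; rintro _ rfl
  refine .op ⟨?_, ?_⟩
  · have hww : w < 2 ^ w := Nat.lt_two_pow_self
    have hw' : (BitVec.ofNat w w).toNat = w := by rw [BitVec.toNat_ofNat, Nat.mod_eq_of_lt hww]
    have hq : (s.reg d / BitVec.ofNat w w + BitVec.ofNat w 1).toNat
        = (s.reg d).toNat / w + 1 := by
      -- Because `w ≥ 2`, the address is at most half of the position, so the address of the next
      -- word does not wrap around.
      have hp : (s.reg d).toNat / w ≤ (s.reg d).toNat / 2 := Nat.div_le_div_left hw (by norm_num)
      have hlt := (s.reg d).isLt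
      have h1 : (BitVec.ofNat w 1).toNat = 1 := by
        rw [BitVec.toNat_ofNat, Nat.mod_eq_of_lt (by omega)]
      rw [BitVec.toNat_add_of_lt, BitVec.toNat_udiv, hw', h1]
      rw [BitVec.toNat_udiv, hw', h1]
      omega
    have := unaligned_read bits (s.reg d) (s.reg (d + 1)) _ _ hl hw' hq
    simpa [WordOp.eval] using this
  · intro r hr
    simp [show r ≠ d by omega, show r ≠ d + 2 by omega, show r ≠ d + 3 by omega,
      show r ≠ d + 4 by omega]

/-! ### Arithmetic expressions and their compilation -/

/-- The arithmetic operations of expressions; subtraction is truncated. -/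
inductive ArithOp where
  | add | sub | mul | div | mod | lt

/-- The value of an operation on natural numbers. -/
def ArithOp.eval : ArithOp → ℕ → ℕ → ℕ
  | .add, x, y => x + y
  | .sub, x, y => x - y
  | .mul, x, y => x * y
  | .div, x, y => x / y
  | .mod, x, y => x % y
  | .lt, x, y => if x < y then 1 else 0

/-- If the operands are less than `P ^ i` and `P ^ j`, the value is less than `P ^ o.deg i j`. -/
def ArithOp.deg : ArithOp → ℕ → ℕ → ℕ
  | .add, i, j => max i j + 1
  | .mul, i, j => i + j
  | .lt, _, _ => 1
  | _, i, j => max i j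

/-- `reg d := o (reg d) (reg (d + 1))`. -/
def ArithOp.code (d : ℕ) : ArithOp → Program
  | .add => .op .add d d (d + 1)
  | .sub => .seq (.op .lt (d + 2) (d + 1) d) (.seq (.op .sub d d (d + 1)) (.op .mul d d (d + 2)))
  | .mul => .op .mul d d (d + 1)
  | .div => .op .div d d (d + 1)
  | .mod => .op .mod d d (d + 1)
  | .lt => .op .lt d d (d + 1)

theorem ArithOp.eval_lt {P x y i j : ℕ} (hP : 2 ≤ P) (o : ArithOp) (hx : x < P ^ i)
    (hy : y < P ^ j) : o.eval x y < P ^ o.deg i j := by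
  have hi : P ^ i ≤ P ^ max i j := Nat.pow_le_pow_right (by omega) (le_max_left _ _)
  have hj : P ^ j ≤ P ^ max i j := Nat.pow_le_pow_right (by omega) (le_max_right _ _)
  cases o <;> simp only [ArithOp.eval, ArithOp.deg]
  · rw [pow_succ]; nlinarith
  · omega
  · rw [pow_add]; exact Nat.mul_lt_mul'' hx hy
  · exact (Nat.div_le_self _ _).trans_lt (hx.trans_le hi)
  · exact (Nat.mod_le _ _).trans_lt (hx.trans_le hi)
  · rw [pow_one]; split <;> omega

theorem ArithOp.computes_code {w : ℕ} (data : BitVec w → BitVec w) (o : ArithOp) (d : ℕ)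
    (s : State w) (hw : 2 ≤ w) (h : o.eval (s.reg d).toNat (s.reg (d + 1)).toNat < 2 ^ w) :
    Computes data (o.code d) s 3 fun s' =>
      (s'.reg d).toNat = o.eval (s.reg d).toNat (s.reg (d + 1)).toNat ∧
      ∀ r < d, s'.reg r = s.reg r := by
  have h1 : 1 < 2 ^ w := Nat.one_lt_two_pow (by omega)
  have hne : ∀ r < d, ∀ x, (s.setReg d x).reg r = s.reg r := by
    intro r hr x; simp [show r ≠ d by omega]
  cases o
  case sub =>
    refine Computes.mono (T := 1 + (1 + 1)) (.seq (.op rfl) ?_) le_rfl fun _ h => h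
    rintro _ rfl
    refine .seq (.op rfl) ?_
    rintro _ rfl
    refine .op ⟨?_, fun r hr => ?_⟩
    · simp only [ArithOp.eval]
      -- The code multiplies the difference by the outcome of this comparison, which turns a wrapped
      -- difference into `0`.
      by_cases hc : (s.reg (d + 1)).toNat < (s.reg d).toNat
      · have := BitVec.toNat_sub_of_le (x := s.reg d) (y := s.reg (d + 1))
          (by rw [BitVec.le_def]; omega)
        simp [WordOp.eval, hc, -BitVec.toNat_sub, this]
      · simp [WordOp.eval, hc]; omega
    · simp [show r ≠ d by omega, show r ≠ d + 2 by omega]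
  all_goals
    refine Computes.mono (T := 1) (.op ⟨?_, fun r hr => hne r hr _⟩) (by omega) fun _ h => h
    simp only [ArithOp.eval] at h
    simp only [State.setReg_reg, if_true, WordOp.eval, ArithOp.eval]
  · rw [BitVec.toNat_add_of_lt h]
  · rw [BitVec.toNat_mul, Nat.mod_eq_of_lt h]
  · rw [BitVec.toNat_udiv]
  · rw [BitVec.toNat_umod]
  · split
    · rw [BitVec.toNat_ofNat, Nat.mod_eq_of_lt h1]
    · simp

/-- Expressions over variables, with conditionals (on being nonzero) and reading of fields of
the bit string. -/
inductive Expr where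
  | var (r : ℕ)
  | const (c : ℕ)
  | bin (o : ArithOp) (a b : Expr)
  | ite (c a b : Expr)
  | read (p l : Expr)

/-- The number of variables of a compiled program. -/
def numVars : ℕ := 16

/-- The value of an expression for the bit string `bits` in the environment `env`. -/
def Expr.val (bits : List Bool) (env : ℕ → ℕ) : Expr → ℕ
  | .var r => env r
  | .const c => c
  | .bin o a b => o.eval (a.val bits env) (b.val bits env)
  | .ite c a b => if c.val bits env ≠ 0 then a.val bits env else b.val bits env
  | .read p l => readBits bits (p.val bits env) (l.val bits env)

/-- If each variable `r` is less than `P ^ δ r`, the value is less than `P ^ e.deg δ`. -/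
def Expr.deg (δ : ℕ → ℕ) : Expr → ℕ
  | .var r => δ r
  | .const _ => 1
  | .bin o a b => o.deg (a.deg δ) (b.deg δ)
  | .ite _ a b => max (a.deg δ) (b.deg δ)
  | .read _ _ => 1

/-- The static check that all intermediate values are less than `P ^ K`. -/
def Expr.safe (δ : ℕ → ℕ) (K : ℕ) : Expr → Bool
  | .var r => decide (r < numVars) && decide (δ r ≤ K)
  | .const c => decide (c < 64) && decide (1 ≤ K)
  | .bin o a b => a.safe δ K && b.safe δ K && decide (o.deg (a.deg δ) (b.deg δ) ≤ K)
  | .ite c a b => c.safe δ K && a.safe δ K && b.safe δ K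
  | .read p l => p.safe δ K && l.safe δ K && decide (1 ≤ K)

/-- No field that is read is longer than `lam` bits. -/
def Expr.ok (bits : List Bool) (lam : ℕ) (env : ℕ → ℕ) : Expr → Prop
  | .var _ => True
  | .const _ => True
  | .bin _ a b => a.ok bits lam env ∧ b.ok bits lam env
  | .ite c a b => c.ok bits lam env ∧ a.ok bits lam env ∧ b.ok bits lam env
  | .read p l => p.ok bits lam env ∧ l.ok bits lam env ∧ l.val bits env ≤ lam

/-- The program that computes an expression into register `d`, using the registers from `d` on. -/
def Expr.compile : Expr → ℕ → Program
  | .var r, d => .op .or d r r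
  | .const c, d => .const d c
  | .bin o a b, d => .seq (a.compile d) (.seq (b.compile (d + 1)) (o.code d))
  | .ite c a b, d => .seq (c.compile d) (.ite d (a.compile d) (b.compile d))
  | .read p l, d => .seq (p.compile d) (.seq (l.compile (d + 1)) (readCode d))

/-- A bound on the running time of the compiled expression. -/
def Expr.cost : Expr → ℕ
  | .var _ => 1
  | .const _ => 1
  | .bin _ a b => a.cost + (b.cost + 3)
  | .ite c a b => c.cost + (a.cost + b.cost + 1)
  | .read p l => p.cost + (l.cost + 13)

theorem Expr.val_lt {bits : List Bool} {lam K : ℕ} {δ env : ℕ → ℕ} (hlam : 6 ≤ lam)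
    (hδ : ∀ r < numVars, env r < (2 ^ lam) ^ δ r) (e : Expr) (hs : e.safe δ K)
    (hok : e.ok bits lam env) : e.val bits env < (2 ^ lam) ^ e.deg δ := by
  -- Constants are less than `64` by the static check; this is why `6 ≤ lam` is required.
  have h64 : 2 ^ 6 ≤ 2 ^ lam := Nat.pow_le_pow_right (by norm_num) hlam
  induction e with
  | var r => simp only [Expr.safe, Bool.and_eq_true, decide_eq_true_eq] at hs; exact hδ r hs.1
  | const c =>
    simp only [Expr.safe, Bool.and_eq_true, decide_eq_true_eq] at hs
    simp only [Expr.val, Expr.deg, pow_one]; omega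
  | bin o a b iha ihb =>
    simp only [Expr.safe, Bool.and_eq_true] at hs
    exact ArithOp.eval_lt (by omega) o (iha hs.1.1 hok.1) (ihb hs.1.2 hok.2)
  | ite c a b _ iha ihb =>
    simp only [Expr.safe, Bool.and_eq_true] at hs
    have ha := iha hs.1.2 hok.2.1
    have hb := ihb hs.2 hok.2.2
    simp only [Expr.val, Expr.deg]
    split
    · exact ha.trans_le (Nat.pow_le_pow_right (by omega) (le_max_left _ _))
    · exact hb.trans_le (Nat.pow_le_pow_right (by omega) (le_max_right _ _))
  | read p l =>
    simp only [Expr.val, Expr.deg, pow_one]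
    exact (readBits_lt _ _ _).trans_le (Nat.pow_le_pow_right (by norm_num) hok.2.2)

theorem Expr.deg_le {δ : ℕ → ℕ} {K : ℕ} (e : Expr) (hs : e.safe δ K) : e.deg δ ≤ K := by
  induction e with
  | ite c a b _ iha ihb =>
    simp only [Expr.safe, Bool.and_eq_true] at hs
    exact max_le (iha hs.1.2) (ihb hs.2)
  | _ =>
    simp only [Expr.safe, Bool.and_eq_true, decide_eq_true_eq] at hs
    exact hs.2

/-- All intermediate values are below `(2 ^ lam) ^ K < 2 ^ w`, so word arithmetic agrees with
arithmetic on natural numbers, and fields of at most `lam < w` bits can be read. Registers below the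
target survive, so a first operand in `d` outlives the evaluation of the second in `d + 1`. -/
theorem Expr.computes_compile {w : ℕ} {bits : List Bool} {lam K : ℕ} {δ env : ℕ → ℕ}
    (hlam : 6 ≤ lam) (hK : 1 ≤ K) (hw : K * lam < w)
    (hδ : ∀ r < numVars, env r < (2 ^ lam) ^ δ r) (e : Expr) (hs : e.safe δ K)
    (hok : e.ok bits lam env) (d : ℕ) (hd : numVars ≤ d) (s : State w)
    (hs' : ∀ r < numVars, (s.reg r).toNat = env r) :
    Computes (dataWord w bits) (e.compile d) s e.cost fun s' =>
      (s'.reg d).toNat = e.val bits env ∧ ∀ r < d, s'.reg r = s.reg r := by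
  have hlw : lam < w := by nlinarith
  have hP : (2 ^ lam) ^ K < 2 ^ w := by
    rw [← pow_mul, mul_comm]; exact Nat.pow_lt_pow_right (by norm_num) hw
  have hlt : ∀ e : Expr, e.safe δ K → e.ok bits lam env → e.val bits env < 2 ^ w := by
    intro e hs hok
    refine (e.val_lt hlam hδ hs hok).trans_le (le_trans ?_ hP.le)
    exact Nat.pow_le_pow_right (by positivity) (e.deg_le hs)
  induction e generalizing d s with
  | var r =>
    simp only [Expr.safe, Bool.and_eq_true, decide_eq_true_eq] at hs
    refine .op ⟨?_, fun r' hr' => ?_⟩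
    · simp [WordOp.eval, hs' r hs.1, Expr.val]
    · simp [show r' ≠ d by omega]
  | const c =>
    refine .const ⟨?_, fun r' hr' => ?_⟩
    · have := hlt _ hs hok
      simp only [Expr.val] at this ⊢
      simp [Nat.mod_eq_of_lt this]
    · simp [show r' ≠ d by omega]
  | bin o a b iha ihb =>
    have h := hlt _ hs hok
    simp only [Expr.safe, Bool.and_eq_true] at hs
    refine .seq (iha hs.1.1 hok.1 d hd s hs') fun s1 h1 => ?_
    refine .seq (ihb hs.1.2 hok.2 (d + 1) (by omega) s1
      fun r hr => by rw [h1.2 r (by omega), hs' r hr]) fun s2 h2 => ?_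
    have e1 : (s2.reg d).toNat = a.val bits env := by rw [h2.2 d (by omega), h1.1]
    refine (o.computes_code _ d s2 (by omega) (by rw [e1, h2.1]; exact h)).mono le_rfl ?_
    rintro s3 ⟨h3, h4⟩
    refine ⟨by rw [h3, e1, h2.1]; rfl, fun r hr => ?_⟩
    rw [h4 r hr, h2.2 r (by omega), h1.2 r hr]
  | ite c a b ihc iha ihb =>
    simp only [Expr.safe, Bool.and_eq_true] at hs
    refine .seq (ihc hs.1.1 hok.1 d hd s hs') fun s1 h1 => ?_
    have h2 : ∀ r < numVars, (s1.reg r).toNat = env r :=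
      fun r hr => by rw [h1.2 r (by omega), hs' r hr]
    have h0 : c.val bits env = 0 ↔ s1.reg d = 0#w := by
      rw [← h1.1, BitVec.toNat_eq]; simp
    simp only [Expr.val]
    refine .ite (fun h => ?_) fun h => ?_
    · rw [if_pos (by rw [Ne, h0]; exact h)]
      exact (iha hs.1.2 hok.2.1 d hd s1 h2).mono le_rfl fun s3 h3 =>
        ⟨h3.1, fun r hr => by rw [h3.2 r hr, h1.2 r hr]⟩
    · rw [if_neg (by rw [not_not, h0]; exact h)]
      exact (ihb hs.2 hok.2.2 d hd s1 h2).mono le_rfl fun s3 h3 =>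
        ⟨h3.1, fun r hr => by rw [h3.2 r hr, h1.2 r hr]⟩
  | read p l ihp ihl =>
    simp only [Expr.safe, Bool.and_eq_true] at hs
    refine .seq (ihp hs.1.1 hok.1 d hd s hs') fun s1 h1 => ?_
    refine .seq (ihl hs.1.2 hok.2.1 (d + 1) (by omega) s1
      fun r hr => by rw [h1.2 r (by omega), hs' r hr]) fun s2 h2 => ?_
    have e1 : (s2.reg d).toNat = p.val bits env := by rw [h2.2 d (by omega), h1.1]
    have hl := hok.2.2
    refine (computes_readCode bits s2 d (by omega) (by rw [h2.1]; omega)).mono le_rfl ?_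
    rintro s3 ⟨h3, h4⟩
    refine ⟨by rw [h3, e1, h2.1]; rfl, fun r hr => ?_⟩
    rw [h4 r hr, h2.2 r (by omega), h1.2 r hr]

/-! ### Sequences of assignments -/

/-- A sequence of assignments `variable := expression`. -/
abbrev Assignments := List (ℕ × Expr)

/-- The environment after the assignments. -/
def Assignments.run (bits : List Bool) : Assignments → (ℕ → ℕ) → ℕ → ℕ
  | [], env => env
  | (v, e) :: as, env => Assignments.run bits as (Function.update env v (e.val bits env))

/-- The static check for assignments. -/
def Assignments.safe (K : ℕ) : Assignments → (ℕ → ℕ) → Bool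
  | [], _ => true
  | (v, e) :: as, δ => e.safe δ K && Assignments.safe K as (Function.update δ v (e.deg δ))

/-- No field that is read is longer than `lam` bits. -/
def Assignments.ok (bits : List Bool) (lam : ℕ) : Assignments → (ℕ → ℕ) → Prop
  | [], _ => True
  | (v, e) :: as, env => e.ok bits lam env ∧
      Assignments.ok bits lam as (Function.update env v (e.val bits env))

/-- The program for a sequence of assignments. -/
def Assignments.compile : Assignments → Program
  | [] => .skip
  | (v, e) :: as => .seq (.seq (e.compile numVars) (.op .or v numVars numVars))
      (Assignments.compile as)

/-- A bound on the running time of a sequence of assignments. -/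
def Assignments.cost : Assignments → ℕ
  | [] => 1
  | (_, e) :: as => e.cost + 1 + Assignments.cost as

/-- The exponents `δ` are updated along with the environment. The final bound `(2 ^ lam) ^ K` on
every variable is what lets a loop restart from a weak bound on its scratch variables. -/
theorem Assignments.computes_compile {w : ℕ} {bits : List Bool} {lam K : ℕ} {δ env : ℕ → ℕ}
    (hlam : 6 ≤ lam) (hK : 1 ≤ K) (hw : K * lam < w) (as : Assignments)
    (hδ : ∀ r < numVars, env r < (2 ^ lam) ^ δ r) (hδK : ∀ r, δ r ≤ K)
    (hs : as.safe K δ) (hok : as.ok bits lam env) (s : State w)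
    (hs' : ∀ r < numVars, (s.reg r).toNat = env r) :
    Computes (dataWord w bits) as.compile s as.cost fun s' =>
      ∀ r < numVars, (s'.reg r).toNat = as.run bits env r ∧
        as.run bits env r < (2 ^ lam) ^ K := by
  induction as generalizing env s δ with
  | nil => exact .skip fun r hr => ⟨hs' r hr, (hδ r hr).trans_le
      (Nat.pow_le_pow_right (by positivity) (hδK r))⟩
  | cons a as ih =>
    obtain ⟨v, e⟩ := a
    simp only [Assignments.safe, Bool.and_eq_true] at hs
    refine .seq (.seq (e.computes_compile hlam hK hw hδ hs.1 hok.1 numVars le_rfl s hs')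
      fun s1 h1 => .op (Q := fun s2 => ∀ r < numVars, (s2.reg r).toNat =
        Function.update env v (e.val bits env) r) ?_) fun s2 h2 => ?_
    · intro r hr
      by_cases hrv : r = v
      · subst hrv; simp [WordOp.eval, h1.1]
      · simp [hrv, h1.2 r hr, hs' r hr]
    · refine ih (δ := Function.update δ v (e.deg δ)) ?_ ?_ hs.2 hok.2 s2 h2
      · intro r hr
        by_cases hrv : r = v
        · subst hrv; simpa using e.val_lt hlam hδ hs.1 hok.1
        · simpa [hrv] using hδ r hr
      · intro r
        by_cases hrv : r = v
        · subst hrv; simpa using e.deg_le hs.1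
        · simpa [hrv] using hδK r

/-! ### Bit strings as arrays of fields -/

theorem mul_add_div_of_lt (q : ℕ) {r b : ℕ} (h : r < b) : (q * b + r) / b = q := by
  rw [mul_comm, Nat.mul_add_div (by omega), Nat.div_eq_of_lt h, add_zero]

theorem mul_add_mod_self_of_lt (q : ℕ) {r b : ℕ} (h : r < b) : (q * b + r) % b = r := by
  rw [mul_comm, Nat.mul_add_mod, Nat.mod_eq_of_lt h]

/-- The bit string of an array of `len` fields of `wd` bits each; field `i` holds `g i`, truncated
to `wd` bits. -/
def fields (wd len : ℕ) (g : ℕ → ℕ) : List Bool :=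
  (List.range (len * wd)).map fun p => (g (p / wd)).testBit (p % wd)

@[simp] theorem length_fields (wd len : ℕ) (g : ℕ → ℕ) : (fields wd len g).length = len * wd := by
  simp [fields]

theorem getD_fields {wd len p : ℕ} (g : ℕ → ℕ) (hp : p < len * wd) :
    (fields wd len g).getD p false = (g (p / wd)).testBit (p % wd) := by
  simp [fields, List.getD_eq_getElem?_getD, hp]

theorem readBits_append_right (as bs : List Bool) {o : ℕ} (ho : as.length = o) (p l : ℕ) :
    readBits (as ++ bs) (o + p) l = readBits bs p l := by
  refine Nat.eq_of_testBit_eq fun k => ?_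
  rw [testBit_readBits, testBit_readBits, List.getD_append_right _ _ _ _ (by omega)]
  congr 2
  omega

theorem readBits_append_left {as : List Bool} (bs : List Bool) {p l : ℕ} (h : p + l ≤ as.length) :
    readBits (as ++ bs) p l = readBits as p l := by
  refine Nat.eq_of_testBit_eq fun k => ?_
  rw [testBit_readBits, testBit_readBits]
  by_cases hk : k < l
  · rw [List.getD_append _ _ _ _ (by omega)]
  · simp [hk]

theorem readBits_fields {wd len i : ℕ} (g : ℕ → ℕ) (hi : i < len) :
    readBits (fields wd len g) (i * wd) wd = g i % 2 ^ wd := by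
  refine Nat.eq_of_testBit_eq fun k => ?_
  rw [testBit_readBits, Nat.testBit_mod_two_pow]
  by_cases hk : k < wd
  · have h1 : i * wd + k < len * wd := by nlinarith
    rw [getD_fields g h1, mul_add_div_of_lt _ hk, mul_add_mod_self_of_lt _ hk]
  · simp [hk]

theorem readBits_fields_append {wd len i : ℕ} (g : ℕ → ℕ) (bs : List Bool) (hi : i < len) :
    readBits (fields wd len g ++ bs) (i * wd) wd = g i % 2 ^ wd := by
  rw [readBits_append_left _ (by rw [length_fields]; nlinarith), readBits_fields g hi]

/-! ### The two-level directory of a monotone function -/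

/-- Block `q` (of length `s`) of `f` is sparse if `f` grows by more than `d` there. -/
def Sparse (f : ℕ → ℕ) (s d q : ℕ) : Prop := d < f (q * s + s) - f (q * s)

instance (f : ℕ → ℕ) (s d : ℕ) : DecidablePred (Sparse f s d) := fun q => by
  unfold Sparse; infer_instance

/-- The blocks are consecutive, and each sparse one adds more than `d` to the growth of `f`; the
others do no harm by monotonicity. -/
theorem count_sparse_mul_le {f : ℕ → ℕ} (hf : Monotone f) (s d m : ℕ) :
    Nat.count (Sparse f s d) m * d ≤ f (m * s) := by
  induction m with
  | zero => simp
  | succ m ih =>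
    rw [Nat.count_succ, add_mul, add_mul, one_mul]
    have h1 : f (m * s) ≤ f (m * s + s) := hf (by omega)
    split_ifs with h
    · unfold Sparse at h; omega
    · omega

theorem count_sparse_lt {f : ℕ → ℕ} (hf : Monotone f) {s d q N : ℕ} (hd : 0 < d)
    (hq : Sparse f s d q) (hN : f (q * s + s) ≤ N) :
    Nat.count (Sparse f s d) q < N / d + 1 := by
  have h := count_sparse_mul_le hf s d (q + 1)
  rw [Nat.count_succ, if_pos hq, add_mul q, one_mul] at h
  have := (Nat.le_div_iff_mul_le hd).2 (h.trans hN)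
  omega

/-- The superblock directory: the value at the start of superblock `Y`; one more than the number of
the superblock among the sparse ones, or `0` if it is dense; the number of sparse blocks before. -/
def superEntry (f : ℕ → ℕ) (b Y t : ℕ) : ℕ :=
  if t = 0 then f (Y * b ^ 3)
  else if t = 1 then
    if Sparse f (b ^ 3) (b ^ 6) Y then Nat.count (Sparse f (b ^ 3) (b ^ 6)) Y + 1 else 0
  else Nat.count (Sparse f b (b ^ 2)) (Y * b ^ 2)

/-- The values of `f` in sparse superblocks. -/
noncomputable def superValue (f : ℕ → ℕ) (b m : ℕ) : ℕ :=
  f (Nat.nth (Sparse f (b ^ 3) (b ^ 6)) (m / b ^ 3) * b ^ 3 + m % b ^ 3)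

/-- The block directory; all values are relative to the superblock. -/
def blockEntry (f : ℕ → ℕ) (b q t : ℕ) : ℕ :=
  if t = 0 then f (q * b) - f (q / b ^ 2 * b ^ 3)
  else if Sparse f b (b ^ 2) q then
    Nat.count (Sparse f b (b ^ 2)) q - Nat.count (Sparse f b (b ^ 2)) (q / b ^ 2 * b ^ 2) + 1
  else 0

/-- The values of `f` in sparse blocks, relative to the superblock. -/
noncomputable def blockValue (f : ℕ → ℕ) (b m : ℕ) : ℕ :=
  f (Nat.nth (Sparse f b (b ^ 2)) (m / b) * b + m % b) -
    f (Nat.nth (Sparse f b (b ^ 2)) (m / b) / b ^ 2 * b ^ 3)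

theorem div_div_sq (b k : ℕ) : k / b / b ^ 2 = k / b ^ 3 := by
  rw [Nat.div_div_eq_div_mul]; congr 1; ring

section Directory

variable {f : ℕ → ℕ} {b n k : ℕ}

/-- Sparse superblocks are stored compactly in the order of their numbers; `Nat.nth` undoes
`Nat.count` at a sparse one, so the count is its address. -/
theorem superValue_eq (hb : 0 < b) (hs : Sparse f (b ^ 3) (b ^ 6) (k / b ^ 3)) :
    superValue f b (Nat.count (Sparse f (b ^ 3) (b ^ 6)) (k / b ^ 3) * b ^ 3 + k % b ^ 3) = f k := by
  have h3 : 0 < b ^ 3 := by positivity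
  rw [superValue, mul_add_div_of_lt _ (Nat.mod_lt _ h3), mul_add_mod_self_of_lt _ (Nat.mod_lt _ h3),
    Nat.nth_count hs, Nat.div_add_mod']

theorem blockValue_eq (hb : 0 < b) (hs : Sparse f b (b ^ 2) (k / b)) :
    blockValue f b (Nat.count (Sparse f b (b ^ 2)) (k / b) * b + k % b) =
      f k - f (k / b ^ 3 * b ^ 3) := by
  rw [blockValue, mul_add_div_of_lt _ (Nat.mod_lt _ hb), mul_add_mod_self_of_lt _ (Nat.mod_lt _ hb),
    Nat.nth_count hs, Nat.div_add_mod', div_div_sq]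

/-- By monotonicity the growth up to `m` is at most the growth over the whole superblock of `k`.
This is what makes relative values short. -/
theorem sub_le_of_dense (hf : Monotone f) (hb : 0 < b) (hs : ¬ Sparse f (b ^ 3) (b ^ 6) (k / b ^ 3))
    {m : ℕ} (hm : m ≤ k) : f m - f (k / b ^ 3 * b ^ 3) ≤ b ^ 6 := by
  have h3 : 0 < b ^ 3 := by positivity
  have h1 : k ≤ k / b ^ 3 * b ^ 3 + b ^ 3 := by
    have := Nat.div_add_mod' k (b ^ 3)
    have := Nat.mod_lt k h3
    omega
  have h2 := hf (hm.trans h1)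
  unfold Sparse at hs
  omega

theorem count_sub_count_le (P : ℕ → Prop) [DecidablePred P] {m n : ℕ} (h : m ≤ n) :
    Nat.count P n - Nat.count P m ≤ n - m := by
  obtain ⟨d, rfl⟩ := Nat.exists_eq_add_of_le h
  rw [Nat.count_add]
  have := Nat.count_le (p := fun k => P (m + k)) (n := d)
  omega

end Directory

/-! ### Rank and select -/

/-- Bit `x` of the bit vector equals `c`; all bits from position `n` on do so, too. -/
def Hit (n : ℕ) (v : ℕ → Bool) (c : Bool) (x : ℕ) : Prop := n ≤ x ∨ v x = c

instance (n : ℕ) (v : ℕ → Bool) (c : Bool) : DecidablePred (Hit n v c) := fun x => by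
  unfold Hit; infer_instance

/-- Select of zeros (`kind = 0`), select of ones (`kind = 1`), and rank of ones (`kind = 2`). -/
noncomputable def query (n : ℕ) (v : ℕ → Bool) (kind : ℕ) : ℕ → ℕ :=
  if kind = 2 then Nat.count (Hit n v true) else Nat.nth (Hit n v (decide (kind = 1)))

/-- The purpose of the padding beyond `n`: on a finite set `Nat.nth` drops to `0` past the last
element, whereas here select is total and strictly monotone for either bit, and its values stay
below a linear bound. -/
theorem infinite_hit (n : ℕ) (v : ℕ → Bool) (c : Bool) : (Set.ofPred (Hit n v c)).Infinite :=
  (Set.Ici_infinite n).mono fun _ hx => Or.inl hx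

theorem count_hit_add (n : ℕ) (v : ℕ → Bool) (c : Bool) (k : ℕ) :
    Nat.count (Hit n v c) (n + k) = Nat.count (Hit n v c) n + k := by
  rw [Nat.count_add, (Nat.count_iff_forall (p := fun k => Hit n v c (n + k))).2]
  exact fun m _ => Or.inl (by omega)

/-- The padding alone supplies `k + 1` hits among the positions `n, …, n + k`. -/
theorem nth_hit_le (n : ℕ) (v : ℕ → Bool) (c : Bool) (k : ℕ) : Nat.nth (Hit n v c) k ≤ n + k := by
  rw [← Nat.lt_succ_iff, ← Nat.lt_nth_iff_count_lt (infinite_hit n v c), Nat.succ_eq_add_one,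
    add_assoc, count_hit_add]
  omega

theorem monotone_query (n : ℕ) (v : ℕ → Bool) (kind : ℕ) : Monotone (query n v kind) := by
  unfold query
  split_ifs
  · exact Nat.count_monotone _
  · exact (Nat.nth_strictMono (infinite_hit _ _ _)).monotone

theorem query_le (n : ℕ) (v : ℕ → Bool) (kind k : ℕ) : query n v kind k ≤ n + k := by
  unfold query
  split_ifs
  · exact (Nat.count_le (p := Hit n v true)).trans (by omega)
  · exact nth_hit_le _ _ _ _

/-- The answer of query `kind` with argument `r` inside a window of bits. -/
noncomputable def windowQuery (kind win r : ℕ) : ℕ :=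
  if kind = 2 then Nat.count (fun t => win.testBit t = true) r
  else Nat.nth (fun t => win.testBit t = decide (kind = 1)) r

theorem count_congr_of_lt {P Q : ℕ → Prop} [DecidablePred P] [DecidablePred Q] {m : ℕ}
    (h : ∀ t < m, (P t ↔ Q t)) : Nat.count P m = Nat.count Q m := by
  induction m with
  | zero => simp
  | succ m ih =>
    rw [Nat.count_succ, Nat.count_succ, ih fun t ht => h t (by omega)]
    simp [h m (by omega)]

section Window

variable {n b k win : ℕ} {v : ℕ → Bool}

/-- A rank query inside a block, by means of the window at the start of the block. -/
theorem rank_eq_add_windowQuery (hb : 0 < b) (hk : k ≤ n)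
    (hwin : ∀ t < b ^ 2, k / b * b + t < n → win.testBit t = v (k / b * b + t)) :
    query n v 2 k = query n v 2 (k / b * b) + windowQuery 2 win (k % b) := by
  have hr := Nat.mod_lt k hb
  have hkb := Nat.div_add_mod' k b
  have hbb : b ≤ b ^ 2 := Nat.le_self_pow (by norm_num) b
  simp only [query, windowQuery, if_true]
  conv_lhs => rw [← hkb, Nat.count_add]
  congr 1
  refine count_congr_of_lt fun t ht => ?_
  have ht' : k / b * b + t < n := by omega
  rw [hwin t (by omega) ht', Hit, or_iff_right (by omega)]

/-- A select query inside a dense block, by means of the window at the value at its start. -/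
theorem select_eq_add_windowQuery {kind : ℕ} (hkind : kind ≠ 2) (hb : 0 < b)
    (hk : query n v kind k < n) (hd : ¬ Sparse (query n v kind) b (b ^ 2) (k / b))
    (hwin : ∀ t < b ^ 2, query n v kind (k / b * b) + t < n →
      win.testBit t = v (query n v kind (k / b * b) + t)) :
    query n v kind k = query n v kind (k / b * b) + windowQuery kind win (k % b) ∧
      windowQuery kind win (k % b) < b ^ 2 := by
  have hr := Nat.mod_lt k hb
  have hkb := Nat.div_add_mod' k b
  have hm := monotone_query n v kind
  have hlt : query n v kind k < query n v kind (k / b * b + b) := by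
    simp only [query, if_neg hkind]
    exact Nat.nth_strictMono (infinite_hit _ _ _) (by omega)
  have hle : query n v kind (k / b * b) ≤ query n v kind k := hm (by omega)
  unfold Sparse at hd
  have hq : query n v kind = Nat.nth (Hit n v (decide (kind = 1))) := by simp [query, hkind]
  rw [hq] at hk hd hwin hm hlt hle ⊢
  set P := Hit n v (decide (kind = 1)) with hP
  set x0 := Nat.nth P (k / b * b) with hx0
  obtain ⟨t, ht⟩ := Nat.exists_eq_add_of_le hle
  have htb : t < b ^ 2 := by omega
  have hagree : ∀ t' ≤ t, P (x0 + t') ↔ win.testBit t' = decide (kind = 1) := by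
    intro t' ht'
    rw [hwin t' (by omega) (by omega), hP, Hit, or_iff_right (by omega)]
  have hPt : P (x0 + t) := ht ▸ Nat.nth_mem_of_infinite (infinite_hit _ _ _) k
  -- Exactly `k` hits precede the answer and `k / b * b` precede the start of the window, so the
  -- window contains `k % b` hits before offset `t`; selecting that hit in the window gives `t`
  -- back.
  have hcount : Nat.count (fun t => win.testBit t = decide (kind = 1)) t = k % b := by
    rw [← count_congr_of_lt fun t' ht' => hagree t' ht'.le]
    have h1 := Nat.count_add P x0 t
    rw [← ht, Nat.count_nth_of_infinite (infinite_hit _ _ _), hx0,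
      Nat.count_nth_of_infinite (infinite_hit _ _ _), ← hx0] at h1
    omega
  have hw : windowQuery kind win (k % b) = t := by
    rw [windowQuery, if_neg hkind, ← hcount]
    exact Nat.nth_count (p := fun t => win.testBit t = decide (kind = 1)) ((hagree t le_rfl).1 hPt)
  rw [hw]
  exact ⟨ht, htb⟩

end Window

/-! ### Layout of the bit string -/

/-- The length `n` and the number `h` of the bit vectors, the block length `b`, and the width `mu`
of relative values. -/
structure Params where
  n : ℕ
  h : ℕ
  b : ℕ
  mu : ℕ

namespace Params

variable (p : Params)

/-- The width of absolute values. -/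
def lam : ℕ := 64 * p.b ^ 2
/-- The number of superblocks. -/
def n1 : ℕ := p.n / p.b ^ 3 + 1
/-- The number of blocks. -/
def n2 : ℕ := p.n / p.b + 1
/-- The room for values in sparse superblocks. -/
def v1 : ℕ := ((2 * p.n + p.b ^ 3) / p.b ^ 6 + 1) * p.b ^ 3
/-- The room for values in sparse blocks. -/
def v2 : ℕ := ((2 * p.n + p.b ^ 3) / p.b ^ 2 + 1) * p.b
/-- The size of the table of window queries. -/
def tab : ℕ := 3 * 2 ^ p.b ^ 2 * p.b

/-- Offset of the superblock directories. -/
def oSuper : ℕ := 19 * p.lam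
/-- Offset of the values in sparse superblocks. -/
def oSuperValue : ℕ := p.oSuper + 3 * p.h * p.n1 * 3 * p.lam
/-- Offset of the block directories. -/
def oBlock : ℕ := p.oSuperValue + 3 * p.h * p.v1 * p.lam
/-- Offset of the values in sparse blocks. -/
def oBlockValue : ℕ := p.oBlock + 3 * p.h * p.n2 * 2 * p.mu
/-- Offset of the table of window queries. -/
def oTable : ℕ := p.oBlockValue + 3 * p.h * p.v2 * p.mu
/-- Offset of the bit vectors. -/
def oBits : ℕ := p.oTable + p.tab * p.mu
/-- The length of the bit string. -/
def total : ℕ := p.oBits + p.h * p.n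

/-- The entries of the header. -/
def header (i : ℕ) : ℕ :=
  [2 ^ (p.lam - 1) - 1, p.lam, p.n, p.h, p.b, p.b ^ 3, p.b ^ 2, 2 ^ p.b ^ 2, p.mu, p.n1, p.n2,
    p.v1, p.v2, p.oSuper, p.oSuperValue, p.oBlock, p.oBlockValue, p.oTable, p.oBits].getD i 0

variable (bit : ℕ → ℕ → Bool)

/-- The functions that are represented: three for each bit vector. -/
noncomputable def fn (i : ℕ) : ℕ → ℕ := query p.n (bit (i / 3)) (i % 3)

/-- The encoding of `h` bit vectors of length `n`. -/
noncomputable def encoding : List Bool :=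
  fields p.lam 19 p.header ++ (
  fields p.lam (3 * p.h * p.n1 * 3)
    (fun m => superEntry (p.fn bit (m / 3 / p.n1)) p.b (m / 3 % p.n1) (m % 3)) ++ (
  fields p.lam (3 * p.h * p.v1) (fun m => superValue (p.fn bit (m / p.v1)) p.b (m % p.v1)) ++ (
  fields p.mu (3 * p.h * p.n2 * 2)
    (fun m => blockEntry (p.fn bit (m / 2 / p.n2)) p.b (m / 2 % p.n2) (m % 2)) ++ (
  fields p.mu (3 * p.h * p.v2) (fun m => blockValue (p.fn bit (m / p.v2)) p.b (m % p.v2)) ++ (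
  fields p.mu p.tab
    (fun m => windowQuery (m / p.b / 2 ^ p.b ^ 2) (m / p.b % 2 ^ p.b ^ 2) (m % p.b)) ++
  fields 1 (p.h * p.n) (fun m => (bit (m / p.n) (m % p.n)).toNat))))))

theorem length_encoding : (p.encoding bit).length = p.total := by
  simp only [encoding, List.length_append, length_fields, total, oBits, oTable, oBlockValue, oBlock,
    oSuperValue, oSuper, mul_one]
  ring

theorem readBits_header {i : ℕ} (hi : i < 19) :
    readBits (p.encoding bit) (i * p.lam) p.lam = p.header i % 2 ^ p.lam :=
  readBits_fields_append _ _ hi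

theorem readBits_super {i Y t : ℕ} (hi : i < 3 * p.h) (hY : Y < p.n1) (ht : t < 3) :
    readBits (p.encoding bit) (p.oSuper + ((i * p.n1 + Y) * 3 + t) * p.lam) p.lam =
      superEntry (p.fn bit i) p.b Y t % 2 ^ p.lam := by
  rw [encoding, readBits_append_right _ _ (by simp [oSuper]), readBits_fields_append]
  · simp only [mul_add_div_of_lt _ ht, mul_add_mod_self_of_lt _ ht, mul_add_div_of_lt _ hY,
      mul_add_mod_self_of_lt _ hY]
  · have : i * p.n1 + Y < 3 * p.h * p.n1 := by nlinarith
    omega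

theorem readBits_superValue {i m : ℕ} (hi : i < 3 * p.h) (hm : m < p.v1) :
    readBits (p.encoding bit) (p.oSuperValue + (i * p.v1 + m) * p.lam) p.lam =
      superValue (p.fn bit i) p.b m % 2 ^ p.lam := by
  rw [encoding, ← List.append_assoc,
    readBits_append_right _ _ (by simp [oSuperValue, oSuper]), readBits_fields_append]
  · simp only [mul_add_div_of_lt _ hm, mul_add_mod_self_of_lt _ hm]
  · nlinarith

theorem readBits_block {i q t : ℕ} (hi : i < 3 * p.h) (hq : q < p.n2) (ht : t < 2) :
    readBits (p.encoding bit) (p.oBlock + ((i * p.n2 + q) * 2 + t) * p.mu) p.mu =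
      blockEntry (p.fn bit i) p.b q t % 2 ^ p.mu := by
  rw [encoding, ← List.append_assoc, ← List.append_assoc,
    readBits_append_right _ _ (by simp [oBlock, oSuperValue, oSuper]; try ring),
    readBits_fields_append]
  · simp only [mul_add_div_of_lt _ ht, mul_add_mod_self_of_lt _ ht, mul_add_div_of_lt _ hq,
      mul_add_mod_self_of_lt _ hq]
  · have : i * p.n2 + q < 3 * p.h * p.n2 := by nlinarith
    omega

theorem readBits_blockValue {i m : ℕ} (hi : i < 3 * p.h) (hm : m < p.v2) :
    readBits (p.encoding bit) (p.oBlockValue + (i * p.v2 + m) * p.mu) p.mu =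
      blockValue (p.fn bit i) p.b m % 2 ^ p.mu := by
  rw [encoding, ← List.append_assoc, ← List.append_assoc, ← List.append_assoc,
    readBits_append_right _ _ (by simp [oBlockValue, oBlock, oSuperValue, oSuper]; try ring),
    readBits_fields_append]
  · simp only [mul_add_div_of_lt _ hm, mul_add_mod_self_of_lt _ hm]
  · nlinarith

theorem readBits_table {kind win r : ℕ} (hk : kind < 3) (hw : win < 2 ^ p.b ^ 2) (hr : r < p.b) :
    readBits (p.encoding bit) (p.oTable + ((kind * 2 ^ p.b ^ 2 + win) * p.b + r) * p.mu) p.mu =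
      windowQuery kind win r % 2 ^ p.mu := by
  rw [encoding, ← List.append_assoc, ← List.append_assoc, ← List.append_assoc, ← List.append_assoc,
    readBits_append_right _ _
      (by simp [oTable, oBlockValue, oBlock, oSuperValue, oSuper]; try ring),
    readBits_fields_append]
  · simp only [mul_add_div_of_lt _ hr, mul_add_mod_self_of_lt _ hr, mul_add_div_of_lt _ hw,
      mul_add_mod_self_of_lt _ hw]
  · have : kind * 2 ^ p.b ^ 2 + win < 3 * 2 ^ p.b ^ 2 := by nlinarith
    rw [tab]
    nlinarith

/-- A window near the end of a vector runs into the next vector or past the string; only its bits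
inside the vector are described, and the query lemmas ask for no others. -/
theorem testBit_window {j x t l : ℕ} (hj : j < p.h) (hx : x + t < p.n) (ht : t < l) :
    (readBits (p.encoding bit) (p.oBits + j * p.n + x) l).testBit t = bit j (x + t) := by
  have h : ∀ m < p.h * p.n, (p.encoding bit).getD (p.oBits + m) false =
      (bit (m / p.n) (m % p.n)) := by
    intro m hm
    have hlen := p.length_encoding bit
    rw [encoding, ← List.append_assoc, ← List.append_assoc, ← List.append_assoc,
      ← List.append_assoc, ← List.append_assoc, List.length_append, length_fields, total,
      mul_one] at hlen
    rw [encoding, ← List.append_assoc, ← List.append_assoc, ← List.append_assoc,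
      ← List.append_assoc, ← List.append_assoc, List.getD_append_right _ _ _ _ (by omega),
      Nat.add_right_cancel hlen, Nat.add_sub_cancel_left, getD_fields _ (by omega)]
    simp only [Nat.div_one, Nat.mod_one]
    cases bit (m / p.n) (m % p.n) <;> rfl
  rw [testBit_readBits, decide_eq_true ht, Bool.true_and, add_assoc, add_assoc, h _ (by nlinarith),
    mul_add_div_of_lt _ hx, mul_add_mod_self_of_lt _ hx]

end Params

/-! ### Bounds on the parameters: every stored value fits into its field -/

namespace Params

/-- The parameters are such that all values fit into their fields. -/
structure Valid (p : Params) : Prop where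
  b_pos : 0 < p.b
  n_lt : p.n < 2 ^ (8 * p.b ^ 2)
  h_pos : 0 < p.h
  h_le : p.h ≤ 8 * p.b ^ 2
  lt_mu : p.b ^ 6 + 1 < 2 ^ p.mu
  mu_le : p.mu ≤ 8 * p.b ^ 2

variable {p : Params}

/-- With `u = 2 ^ b ^ 2` we have `n < u ^ 8`, and each array takes at most a constant times `u ^ 13`
bits, far below `u ^ 64 = 2 ^ lam`. Hence all offsets fit into header fields. -/
theorem Valid.total_lt (hp : p.Valid) : p.total < 2 ^ p.lam := by
  obtain ⟨hb, hn, -, hh, -, hmu⟩ := hp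
  rw [pow_mul'] at hn
  rw [total, oBits, oTable, oBlockValue, oBlock, oSuperValue, oSuper, tab]
  obtain ⟨u, hu⟩ : ∃ u, u = 2 ^ p.b ^ 2 := ⟨_, rfl⟩
  have hlam : 2 ^ p.lam = u ^ 64 := by rw [hu, ← pow_mul, lam, mul_comm]
  rw [hlam]
  rw [← hu] at hn ⊢
  have hsq : p.b ^ 2 < u := hu ▸ Nat.lt_two_pow_self
  have hbb : p.b ≤ p.b ^ 2 := Nat.le_self_pow (by norm_num) _
  have hu2 : 2 ≤ u := by omega
  have hlam' : p.lam ≤ 64 * u := by rw [lam]; omega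
  have hn1 : p.n1 ≤ u ^ 8 := by
    have := Nat.div_le_self p.n (p.b ^ 3)
    rw [n1]; omega
  have hn2 : p.n2 ≤ u ^ 8 := by
    have := Nat.div_le_self p.n p.b
    rw [n2]; omega
  have hb3 : p.b ^ 3 ≤ u ^ 3 := Nat.pow_le_pow_left (by omega) 3
  have h38 : u ^ 3 ≤ u ^ 8 := Nat.pow_le_pow_right (by omega) (by norm_num)
  have hv1 : p.v1 ≤ 4 * u ^ 11 := by
    have := Nat.div_le_self (2 * p.n + p.b ^ 3) (p.b ^ 6)
    calc p.v1 ≤ (4 * u ^ 8) * u ^ 3 := by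
          rw [v1]; exact Nat.mul_le_mul (by omega) hb3
      _ = 4 * u ^ 11 := by ring
  have hv2 : p.v2 ≤ 4 * u ^ 11 := by
    have := Nat.div_le_self (2 * p.n + p.b ^ 3) (p.b ^ 2)
    have h13 : u ≤ u ^ 3 := Nat.le_self_pow (by norm_num) _
    calc p.v2 ≤ (4 * u ^ 8) * u ^ 3 := by
          rw [v2]; exact Nat.mul_le_mul (by omega) (by omega)
      _ = 4 * u ^ 11 := by ring
  have hh' : p.h ≤ 8 * u := by omega
  have hmu' : p.mu ≤ 8 * u := by omega
  have hbu : p.b ≤ u := by omega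
  have e (k c : ℕ) (hk : k ≤ 13) : c * u ^ k ≤ c * u ^ 13 :=
    Nat.mul_le_mul_left _ (Nat.pow_le_pow_right (by omega) hk)
  have t0 : 19 * p.lam ≤ 1216 * u ^ 13 :=
    (show 19 * p.lam ≤ 1216 * u ^ 1 by rw [pow_one]; omega).trans (e 1 _ (by norm_num))
  have t1 : 3 * p.h * p.n1 * 3 * p.lam ≤ 4608 * u ^ 13 :=
    calc _ ≤ 3 * (8 * u) * u ^ 8 * 3 * (64 * u) := by gcongr
      _ = 4608 * u ^ 10 := by ring
      _ ≤ _ := e 10 _ (by norm_num)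
  have t2 : 3 * p.h * p.v1 * p.lam ≤ 6144 * u ^ 13 :=
    calc _ ≤ 3 * (8 * u) * (4 * u ^ 11) * (64 * u) := by gcongr
      _ = 6144 * u ^ 13 := by ring
  have t3 : 3 * p.h * p.n2 * 2 * p.mu ≤ 384 * u ^ 13 :=
    calc _ ≤ 3 * (8 * u) * u ^ 8 * 2 * (8 * u) := by gcongr
      _ = 384 * u ^ 10 := by ring
      _ ≤ _ := e 10 _ (by norm_num)
  have t4 : 3 * p.h * p.v2 * p.mu ≤ 768 * u ^ 13 :=
    calc _ ≤ 3 * (8 * u) * (4 * u ^ 11) * (8 * u) := by gcongr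
      _ = 768 * u ^ 13 := by ring
  have t5 : 3 * u * p.b * p.mu ≤ 24 * u ^ 13 :=
    calc _ ≤ 3 * u * u * (8 * u) := by gcongr
      _ = 24 * u ^ 3 := by ring
      _ ≤ _ := e 3 _ (by norm_num)
  have t6 : p.h * p.n ≤ 8 * u ^ 13 :=
    calc _ ≤ 8 * u * u ^ 8 := by gcongr
      _ = 8 * u ^ 9 := by ring
      _ ≤ _ := e 9 _ (by norm_num)
  have h14 : 2 ^ 14 ≤ u ^ 14 := Nat.pow_le_pow_left hu2 14
  -- The coefficients of the seven bounds add up to `13152 < 2 ^ 14`.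
  calc _ < 2 ^ 14 * u ^ 13 := by have : 0 < u ^ 13 := by positivity
                                 omega
    _ ≤ u ^ 14 * u ^ 13 := by gcongr
    _ = u ^ 27 := by ring
    _ ≤ u ^ 64 := Nat.pow_le_pow_right (by omega) (by norm_num)

theorem Valid.six_le_lam (hp : p.Valid) : 6 ≤ p.lam := by
  have := Nat.pow_pos (n := 2) hp.b_pos
  rw [lam]; omega

theorem Valid.two_mul_n_lt (hp : p.Valid) : 2 * p.n + 2 < 2 ^ p.lam := by
  have h1 := hp.n_lt
  have h2 := Nat.pow_pos (n := 2) hp.b_pos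
  have h3 : 2 ^ (8 * p.b ^ 2 + 2) ≤ 2 ^ p.lam := by
    apply Nat.pow_le_pow_right (by norm_num)
    rw [lam]; omega
  rw [pow_add] at h3
  omega

theorem Valid.header_lt (hp : p.Valid) {i : ℕ} (hi : i < 19) : p.header i < 2 ^ p.lam := by
  have htot := hp.total_lt
  have hlam : p.lam < 2 ^ p.lam := Nat.lt_two_pow_self
  have hpos : 0 < p.b ^ 2 := Nat.pow_pos hp.b_pos
  have hh := hp.h_pos
  have hh' := hp.h_le
  have hmu := hp.mu_le
  have hl : p.lam = 64 * p.b ^ 2 := rfl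
  have h2 : 2 ^ (p.lam - 1) ≤ 2 ^ p.lam := Nat.pow_le_pow_right (by norm_num) (by omega)
  have h2' : 0 < 2 ^ (p.lam - 1) := by positivity
  have hu : 2 ^ p.b ^ 2 < 2 ^ p.lam := Nat.pow_lt_pow_right (by norm_num) (by omega)
  have hbb : p.b ≤ p.b ^ 2 := Nat.le_self_pow (by norm_num) _
  have hb3 : p.b ^ 3 < 2 ^ p.lam := by
    have h36 : p.b ^ 3 ≤ p.b ^ 6 := Nat.pow_le_pow_right hp.b_pos (by norm_num)
    have := hp.lt_mu
    have : 2 ^ p.mu ≤ 2 ^ p.lam := Nat.pow_le_pow_right (by norm_num) (by omega)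
    omega
  have hn := hp.two_mul_n_lt
  have hn1 : p.n1 ≤ p.n + 1 := Nat.succ_le_succ (Nat.div_le_self p.n (p.b ^ 3))
  have hn2 : p.n2 ≤ p.n + 1 := Nat.succ_le_succ (Nat.div_le_self p.n p.b)
  have hv1 : p.v1 ≤ 3 * p.h * p.v1 * p.lam :=
    calc p.v1 = 1 * p.v1 * 1 := by ring
      _ ≤ _ := by gcongr <;> omega
  have hv2 : p.v2 ≤ 3 * p.h * p.v2 * p.mu := by
    have : 0 < p.mu := by
      by_contra h
      have := hp.lt_mu
      rw [show p.mu = 0 by omega] at this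
      omega
    calc p.v2 = 1 * p.v2 * 1 := by ring
      _ ≤ _ := by gcongr <;> omega
  have e1 : p.total = p.oBits + p.h * p.n := rfl
  have e2 : p.oBits = p.oTable + p.tab * p.mu := rfl
  have e3 : p.oTable = p.oBlockValue + 3 * p.h * p.v2 * p.mu := rfl
  have e4 : p.oBlockValue = p.oBlock + 3 * p.h * p.n2 * 2 * p.mu := rfl
  have e5 : p.oBlock = p.oSuperValue + 3 * p.h * p.v1 * p.lam := rfl
  have e6 : p.oSuperValue = p.oSuper + 3 * p.h * p.n1 * 3 * p.lam := rfl
  interval_cases i <;>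
    simp only [header, List.getD_cons_zero, List.getD_cons_succ] <;> omega

end Params

/-! ### Lookups that return the stored value without truncation -/

namespace Params

section Lookup

variable {p : Params} {bit : ℕ → ℕ → Bool} {i k : ℕ}

theorem monotone_fn (p : Params) (bit : ℕ → ℕ → Bool) (i : ℕ) : Monotone (p.fn bit i) :=
  monotone_query _ _ _

theorem fn_le (p : Params) (bit : ℕ → ℕ → Bool) (i k : ℕ) : p.fn bit i k ≤ p.n + k :=
  query_le _ _ _ _

theorem div_lt_n1 (hk : k ≤ p.n) : k / p.b ^ 3 < p.n1 :=
  Nat.lt_succ_of_le (Nat.div_le_div_right hk)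

theorem div_lt_n2 (hk : k ≤ p.n) : k / p.b < p.n2 :=
  Nat.lt_succ_of_le (Nat.div_le_div_right hk)

theorem read_super (hp : p.Valid) (hi : i < 3 * p.h) (hk : k ≤ p.n) {t : ℕ} (ht : t < 3) :
    readBits (p.encoding bit) (p.oSuper + ((i * p.n1 + k / p.b ^ 3) * 3 + t) * p.lam) p.lam =
      superEntry (p.fn bit i) p.b (k / p.b ^ 3) t := by
  rw [p.readBits_super bit hi (div_lt_n1 hk) ht, Nat.mod_eq_of_lt]
  have hn := hp.two_mul_n_lt
  have h1 : k / p.b ^ 3 * p.b ^ 3 ≤ k := Nat.div_mul_le_self _ _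
  have h2 : k / p.b ^ 3 ≤ k := Nat.div_le_self _ _
  have h3 : k / p.b ^ 3 * p.b ^ 2 ≤ k / p.b ^ 3 * p.b ^ 3 :=
    Nat.mul_le_mul_left _ (Nat.pow_le_pow_right hp.b_pos (by norm_num))
  rw [superEntry]
  split_ifs
  · have := p.fn_le bit i (k / p.b ^ 3 * p.b ^ 3)
    omega
  · have := Nat.count_le (p := Sparse (p.fn bit i) (p.b ^ 3) (p.b ^ 6)) (n := k / p.b ^ 3)
    omega
  · omega
  · have := Nat.count_le (p := Sparse (p.fn bit i) p.b (p.b ^ 2)) (n := k / p.b ^ 3 * p.b ^ 2)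
    omega

theorem read_superValue (hp : p.Valid) (hi : i < 3 * p.h) (hk : k ≤ p.n)
    (hs : Sparse (p.fn bit i) (p.b ^ 3) (p.b ^ 6) (k / p.b ^ 3)) :
    readBits (p.encoding bit) (p.oSuperValue + (i * p.v1 +
      (Nat.count (Sparse (p.fn bit i) (p.b ^ 3) (p.b ^ 6)) (k / p.b ^ 3) * p.b ^ 3 + k % p.b ^ 3))
        * p.lam) p.lam = p.fn bit i k := by
  have hb := hp.b_pos
  have h3 : 0 < p.b ^ 3 := by positivity
  have hr := Nat.mod_lt k h3
  -- The value at the end of the superblock is at most `n + (k + b ^ 3) ≤ 2 * n + b ^ 3`; the room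
  -- `v1` is computed from this bound.
  have hc := count_sparse_lt (p.monotone_fn bit i) (by positivity) hs
    (N := 2 * p.n + p.b ^ 3) ((p.fn_le bit i _).trans (by
      have := Nat.div_mul_le_self k (p.b ^ 3)
      omega))
  rw [p.readBits_superValue bit hi, superValue_eq hb hs, Nat.mod_eq_of_lt]
  · have := p.fn_le bit i k
    have := hp.two_mul_n_lt
    omega
  · rw [v1]
    nlinarith

/-- Density of the superblock is essential: only then are relative values at most `b ^ 6` and fit
into `mu` bits. In sparse superblocks these fields may be truncated, but they do not affect the
answer. -/
theorem read_block (hp : p.Valid) (hi : i < 3 * p.h) (hk : k ≤ p.n)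
    (hs : ¬ Sparse (p.fn bit i) (p.b ^ 3) (p.b ^ 6) (k / p.b ^ 3)) {t : ℕ} (ht : t < 2) :
    readBits (p.encoding bit) (p.oBlock + ((i * p.n2 + k / p.b) * 2 + t) * p.mu) p.mu =
      blockEntry (p.fn bit i) p.b (k / p.b) t := by
  have hb := hp.b_pos
  have hmu := hp.lt_mu
  rw [p.readBits_block bit hi (div_lt_n2 hk) ht, Nat.mod_eq_of_lt]
  rw [blockEntry]
  split_ifs
  · have := sub_le_of_dense (p.monotone_fn bit i) hb hs (Nat.div_mul_le_self k p.b)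
    rw [div_div_sq]
    omega
  · have h1 := count_sub_count_le (Sparse (p.fn bit i) p.b (p.b ^ 2))
      (Nat.div_mul_le_self (k / p.b) (p.b ^ 2))
    have h2 := Nat.div_add_mod' (k / p.b) (p.b ^ 2)
    have h3 := Nat.mod_lt (k / p.b) (show 0 < p.b ^ 2 by positivity)
    have h4 : p.b ^ 2 ≤ p.b ^ 6 := Nat.pow_le_pow_right hb (by norm_num)
    omega
  · omega

theorem read_blockValue (hp : p.Valid) (hi : i < 3 * p.h) (hk : k ≤ p.n)
    (hs : ¬ Sparse (p.fn bit i) (p.b ^ 3) (p.b ^ 6) (k / p.b ^ 3))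
    (hs' : Sparse (p.fn bit i) p.b (p.b ^ 2) (k / p.b)) :
    readBits (p.encoding bit) (p.oBlockValue + (i * p.v2 +
      (Nat.count (Sparse (p.fn bit i) p.b (p.b ^ 2)) (k / p.b) * p.b + k % p.b)) * p.mu) p.mu =
      p.fn bit i k - p.fn bit i (k / p.b ^ 3 * p.b ^ 3) := by
  have hb := hp.b_pos
  have hr := Nat.mod_lt k hb
  have hbb : p.b ≤ p.b ^ 3 := Nat.le_self_pow (by norm_num) _
  have hc := count_sparse_lt (p.monotone_fn bit i) (by positivity) hs'
    (N := 2 * p.n + p.b ^ 3) ((p.fn_le bit i _).trans (by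
      have := Nat.div_mul_le_self k p.b
      omega))
  rw [p.readBits_blockValue bit hi, blockValue_eq hb hs', Nat.mod_eq_of_lt]
  · have := sub_le_of_dense (p.monotone_fn bit i) hb hs le_rfl
    have := hp.lt_mu
    omega
  · rw [v2]
    nlinarith

theorem read_table (hp : p.Valid) {kind win r : ℕ} (hkind : kind < 3) (hw : win < 2 ^ p.b ^ 2)
    (hr : r < p.b) (hq : windowQuery kind win r ≤ p.b ^ 2) :
    readBits (p.encoding bit) (p.oTable + ((kind * 2 ^ p.b ^ 2 + win) * p.b + r) * p.mu) p.mu =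
      windowQuery kind win r := by
  rw [p.readBits_table bit hkind hw hr, Nat.mod_eq_of_lt]
  have := hp.lt_mu
  have : p.b ^ 2 ≤ p.b ^ 6 := Nat.pow_le_pow_right hp.b_pos (by norm_num)
  omega

end Lookup

section Header

variable (p : Params)

theorem header_two : p.header 2 = p.n := rfl
theorem header_three : p.header 3 = p.h := rfl
theorem header_four : p.header 4 = p.b := rfl
theorem header_five : p.header 5 = p.b ^ 3 := rfl
theorem header_six : p.header 6 = p.b ^ 2 := rfl
theorem header_seven : p.header 7 = 2 ^ p.b ^ 2 := rfl
theorem header_eight : p.header 8 = p.mu := rfl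
theorem header_nine : p.header 9 = p.n1 := rfl
theorem header_ten : p.header 10 = p.n2 := rfl
theorem header_eleven : p.header 11 = p.v1 := rfl
theorem header_twelve : p.header 12 = p.v2 := rfl
theorem header_thirteen : p.header 13 = p.oSuper := rfl
theorem header_fourteen : p.header 14 = p.oSuperValue := rfl
theorem header_fifteen : p.header 15 = p.oBlock := rfl
theorem header_sixteen : p.header 16 = p.oBlockValue := rfl
theorem header_seventeen : p.header 17 = p.oTable := rfl
theorem header_eighteen : p.header 18 = p.oBits := rfl

end Header

end Params

/-! ### The program for rank and select queries -/

instance : Add Expr := ⟨.bin .add⟩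
instance : Sub Expr := ⟨.bin .sub⟩
instance : Mul Expr := ⟨.bin .mul⟩
instance : Div Expr := ⟨.bin .div⟩
instance : Mod Expr := ⟨.bin .mod⟩

namespace Expr

/-- Entry `i` of the header; variable `1` holds the width. -/
def hdr (i : ℕ) : Expr := .read (.const i * .var 1) (.var 1)

/-- The condition `a < b`. -/
def less (a b : Expr) : Expr := .bin .lt a b

variable {bits : List Bool} {lam : ℕ} {env : ℕ → ℕ} (a b c : Expr)

theorem val_sub : (a - b).val bits env = a.val bits env - b.val bits env := rfl
theorem val_div : (a / b).val bits env = a.val bits env / b.val bits env := rfl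
theorem val_less :
    (less a b).val bits env = if a.val bits env < b.val bits env then 1 else 0 := rfl
theorem ok_sub : (a - b).ok bits lam env ↔ a.ok bits lam env ∧ b.ok bits lam env := Iff.rfl
theorem ok_div : (a / b).ok bits lam env ↔ a.ok bits lam env ∧ b.ok bits lam env := Iff.rfl
theorem ok_less : (less a b).ok bits lam env ↔ a.ok bits lam env ∧ b.ok bits lam env := Iff.rfl

theorem ok_hdr {i : ℕ} (h : env 1 = lam) : (hdr i).ok bits lam env :=
  ⟨⟨trivial, trivial⟩, trivial, h.le⟩

theorem val_hdr {p : Params} (hp : p.Valid) {bit : ℕ → ℕ → Bool} {i : ℕ} (hi : i < 19)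
    (h : env 1 = p.lam) : (hdr i).val (p.encoding bit) env = p.header i := by
  change readBits _ (i * env 1) (env 1) = _
  rw [h, p.readBits_header bit hi, Nat.mod_eq_of_lt (hp.header_lt hi)]

end Expr

open SuccinctPerm.Expr in
/-- Variable `13` is set to the answer of the query number `var 15` to bit vector `var 2` with
argument `var 4`. -/
def queryCode : Assignments :=
  [(5, .const 3 * .var 2 + .var 15),
   (6, .var 5 * hdr 9 + .var 4 / hdr 5),
   (7, .read (hdr 13 + (.var 6 * .const 3 + .const 0) * .var 1) (.var 1)),
   (8, .read (hdr 13 + (.var 6 * .const 3 + .const 1) * .var 1) (.var 1)),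
   (9, .var 5 * hdr 10 + .var 4 / hdr 4),
   (10, .read (hdr 15 + (.var 9 * .const 2 + .const 0) * hdr 8) (hdr 8)),
   (11, .read (hdr 15 + (.var 9 * .const 2 + .const 1) * hdr 8) (hdr 8)),
   (12, .ite (less (.var 15) (.const 2)) (.var 7 + .var 10) (.var 4 / hdr 4 * hdr 4)),
   (13, .ite (.var 8)
      (.read (hdr 14 + (.var 5 * hdr 11 +
        ((.var 8 - .const 1) * hdr 5 + .var 4 % hdr 5)) * .var 1) (.var 1))
      (.ite (.var 11)
        (.var 7 + .read (hdr 16 + (.var 5 * hdr 12 +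
          ((.read (hdr 13 + (.var 6 * .const 3 + .const 2) * .var 1) (.var 1) + .var 11 - .const 1)
            * hdr 4 + .var 4 % hdr 4)) * hdr 8) (hdr 8))
        (.var 7 + .var 10 + .read (hdr 17 + ((.var 15 * hdr 7 +
          .read (hdr 18 + .var 2 * hdr 2 + .var 12) (hdr 6)) * hdr 4 + .var 4 % hdr 4) * hdr 8)
            (hdr 8))))]

theorem Assignments.run_of_notMem {bits : List Bool} {r : ℕ} (as : Assignments) (env : ℕ → ℕ)
    (h : r ∉ as.map Prod.fst) : as.run bits env r = env r := by
  induction as generalizing env with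
  | nil => rfl
  | cons a as ih =>
    simp only [List.map_cons, List.mem_cons, not_or] at h
    rw [Assignments.run, ih _ h.2, Function.update_of_ne h.1]

theorem Assignments.run_append {bits : List Bool} (as bs : Assignments) (env : ℕ → ℕ) :
    Assignments.run bits (as ++ bs) env = bs.run bits (as.run bits env) := by
  induction as generalizing env with
  | nil => rfl
  | cons a as ih => exact ih _

theorem Assignments.ok_append {bits : List Bool} {lam : ℕ} (as bs : Assignments) (env : ℕ → ℕ) :
    Assignments.ok bits lam (as ++ bs) env ↔
      as.ok bits lam env ∧ bs.ok bits lam (as.run bits env) := by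
  induction as generalizing env with
  | nil => exact (true_and _).symm.to_iff
  | cons a as ih => simp only [List.cons_append, Assignments.ok, Assignments.run, ih, and_assoc]

section QueryCode

open Params

variable {p : Params} {bit : ℕ → ℕ → Bool} {env : ℕ → ℕ}

theorem ok_queryCode (hp : p.Valid) (h1 : env 1 = p.lam) :
    queryCode.ok (p.encoding bit) p.lam env := by
  have hb : p.b ^ 2 ≤ p.lam := by rw [Params.lam]; omega
  have hmu : p.mu ≤ p.lam := by have := hp.mu_le; rw [Params.lam]; omega
  simp [queryCode, Assignments.ok, Expr.ok, Expr.ok_sub, Expr.ok_div,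
    Expr.ok_less, Expr.ok_hdr, Expr.val_hdr hp, h1, header_six, header_eight, hb, hmu, Expr.val]

/-- Three cases: a sparse superblock (stored value), a sparse block in a dense superblock (base plus
stored relative value), a dense block (value at its start plus table entry). Variables `8` and `11`
are `0` in the dense case and otherwise one more than the index of the explicit values, the second
index being relative to the superblock. Rank needs no proof that it is dense, since every branch is
correct. -/
theorem run_queryCode (hp : p.Valid) {j kind k : ℕ} (h1 : env 1 = p.lam) (h2 : env 2 = j)
    (h4 : env 4 = k) (h15 : env 15 = kind) (hj : j < p.h) (hkind : kind < 3) (hk : k ≤ p.n)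
    (hq : kind = 2 ∨ query p.n (bit j) kind k < p.n) :
    queryCode.run (p.encoding bit) env 13 = query p.n (bit j) kind k := by
  obtain ⟨i, hi⟩ : ∃ i, i = 3 * j + kind := ⟨_, rfl⟩
  have hi' : i < 3 * p.h := by omega
  have hf : p.fn bit i = query p.n (bit j) kind := by
    rw [Params.fn, hi, Nat.mul_add_div (by norm_num), Nat.mul_add_mod, Nat.div_eq_of_lt hkind,
      Nat.mod_eq_of_lt hkind, add_zero]
  have hb := hp.b_pos
  have hkb := Nat.div_mul_le_self k p.b
  have hm := p.monotone_fn bit i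
  have hS (t : ℕ) (ht : t < 3) := read_super (bit := bit) hp hi' hk ht
  have hlow : p.fn bit i (k / p.b ^ 3 * p.b ^ 3) ≤ p.fn bit i k := hm (Nat.div_mul_le_self _ _)
  simp only [queryCode, Assignments.run]
  simp [Expr.val_sub, Expr.val_div, Expr.val_less, Expr.val_hdr hp, h1, Expr.val, h2, h4, h15]
  simp only [ArithOp.eval, header_two, header_four, header_five, header_six, header_seven,
    header_eight, header_nine, header_ten, header_eleven, header_twelve, header_thirteen,
    header_fourteen, header_fifteen, header_sixteen, header_seventeen, header_eighteen, ← hi]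
  rw [hS 0 (by norm_num), hS 1 (by norm_num), hS 2 (by norm_num)]
  simp only [superEntry, if_true, one_ne_zero, if_false, two_ne_zero, OfNat.ofNat_ne_one]
  by_cases hs : Sparse (p.fn bit i) (p.b ^ 3) (p.b ^ 6) (k / p.b ^ 3)
  · rw [if_neg (by rw [if_pos hs]; omega), if_pos hs, Nat.add_sub_cancel,
      read_superValue hp hi' hk hs, hf]
  rw [if_neg hs, if_pos rfl]
  have hB (t : ℕ) (ht : t < 2) := read_block hp hi' hk hs ht
  rw [hB 0 (by norm_num), hB 1 (by norm_num)]
  simp only [blockEntry, if_true, one_ne_zero, if_false, div_div_sq]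
  by_cases hs' : Sparse (p.fn bit i) p.b (p.b ^ 2) (k / p.b)
  · rw [if_neg (by rw [if_pos hs']; omega), if_pos hs']
    have hc : Nat.count (Sparse (p.fn bit i) p.b (p.b ^ 2)) (k / p.b ^ 3 * p.b ^ 2) ≤
        Nat.count (Sparse (p.fn bit i) p.b (p.b ^ 2)) (k / p.b) := by
      refine Nat.count_monotone _ ?_
      rw [← div_div_sq]
      exact Nat.div_mul_le_self _ _
    have e : ∀ a c : ℕ, a ≤ c → a + (c - a + 1) - 1 = c := by omega
    rw [e _ _ hc,
      read_blockValue hp hi' hk hs hs', Nat.add_sub_cancel' hlow, hf]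
  rw [if_neg hs', if_pos rfl]
  have hlow' : p.fn bit i (k / p.b ^ 3 * p.b ^ 3) ≤ p.fn bit i (k / p.b * p.b) := by
    refine hm ?_
    rw [← div_div_sq, pow_succ p.b 2, ← mul_assoc]
    exact Nat.mul_le_mul_right _ (Nat.div_mul_le_self _ _)
  rw [Nat.add_sub_cancel' hlow']
  -- For select the window starts at the value of the function at the block start, for rank at the
  -- block start itself.
  obtain ⟨win, hwin⟩ : ∃ win, win = readBits (p.encoding bit) (p.oBits + j * p.n +
      (if kind ≤ 1 then p.fn bit i (k / p.b * p.b) else k / p.b * p.b)) (p.b ^ 2) := ⟨_, rfl⟩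
  rw [← hwin]
  have hr := Nat.mod_lt k hb
  have hbb : p.b ≤ p.b ^ 2 := Nat.le_self_pow (by norm_num) _
  have hw : win < 2 ^ p.b ^ 2 := hwin ▸ readBits_lt _ _ _
  by_cases h2k : kind = 2
  · subst h2k
    have := rank_eq_add_windowQuery (v := bit j) (win := win) hb hk fun t ht htn => by
      rw [hwin, if_neg (by norm_num)]
      exact p.testBit_window bit hj htn ht
    rw [read_table hp hkind hw hr, hf, this]
    rw [windowQuery, if_pos rfl]
    exact (Nat.count_le (p := fun t => win.testBit t = true)).trans (by omega)
  · rw [hf] at hs' hwin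
    obtain ⟨h3, h5⟩ := select_eq_add_windowQuery (v := bit j) (win := win) h2k hb
        (hq.resolve_left h2k) hs' fun t ht htn => by
      rw [hwin, if_pos (by omega)]
      exact p.testBit_window bit hj htn ht
    rw [read_table hp hkind hw hr h5.le, hf, ← h3]

end QueryCode

/-! ### Radix sort by stable partitions -/

section Radix

variable {n : ℕ} (S : Fin n → ℕ) (j : ℕ)

/-- The sorting key of `v` after `j` rounds: the low `j` bits of `S v`, then `v`. -/
def sortKey (v : Fin n) : ℕ := S v % 2 ^ j * n + v

/-- The position of `v` after `j` rounds. -/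
def pos (v : Fin n) : ℕ := (Finset.univ.filter fun u => sortKey S j u < sortKey S j v).card

open Classical in
/-- The bit vector of round `j`: bit `j` of `S v` at the position of `v`. -/
noncomputable def roundBits (x : ℕ) : Bool := decide (∃ u, pos S j u = x ∧ (S u).testBit j = true)

theorem pos_lt_pos {u v : Fin n} : pos S j u < pos S j v ↔ sortKey S j u < sortKey S j v := by
  have mono : ∀ {u v : Fin n}, sortKey S j u ≤ sortKey S j v → pos S j u ≤ pos S j v := by
    intro u v h
    refine Finset.card_le_card fun x hx => ?_
    simp only [Finset.mem_filter, Finset.mem_univ, true_and] at hx ⊢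
    omega
  constructor
  · intro h
    by_contra h'
    exact absurd (mono (not_lt.1 h')) (not_le.2 h)
  · intro h
    refine Finset.card_lt_card (Finset.ssubset_iff_of_subset ?_ |>.2 ⟨u, ?_, ?_⟩)
    · intro x hx
      simp only [Finset.mem_filter, Finset.mem_univ, true_and] at hx ⊢
      omega
    · simpa using h
    · simp

theorem sortKey_injective : Function.Injective (sortKey S j) := by
  intro u v h
  have := congrArg (· % n) h
  simp only [sortKey, mul_add_mod_self_of_lt _ u.2, mul_add_mod_self_of_lt _ v.2] at this
  exact Fin.ext this

theorem pos_injective : Function.Injective (pos S j) := by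
  intro u v h
  have h1 := pos_lt_pos S j (u := u) (v := v)
  have h2 := pos_lt_pos S j (u := v) (v := u)
  exact sortKey_injective S j (by omega)

theorem pos_lt (v : Fin n) : pos S j v < n := by
  conv_rhs => rw [← Fintype.card_fin n, ← Finset.card_univ]
  refine Finset.card_lt_card (Finset.ssubset_iff_of_subset (Finset.subset_univ _) |>.2 ⟨v, ?_, ?_⟩)
  · simp
  · simp

theorem exists_pos_eq {x : ℕ} (hx : x < n) : ∃ u, pos S j u = x := by
  have : Function.Injective fun u => (⟨pos S j u, pos_lt S j u⟩ : Fin n) :=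
    fun u v h => pos_injective S j (Fin.mk.inj_iff.1 h)
  obtain ⟨u, hu⟩ := Finite.surjective_of_injective this ⟨x, hx⟩
  exact ⟨u, Fin.mk.inj_iff.1 hu⟩

theorem roundBits_pos (u : Fin n) : roundBits S j (pos S j u) = (S u).testBit j := by
  rw [Bool.eq_iff_iff, roundBits, decide_eq_true_eq]
  exact ⟨fun ⟨v, hv, h⟩ => pos_injective S j hv ▸ h, fun h => ⟨u, rfl, h⟩⟩

/-- The map `pos` is a bijection from elements to positions, so counting bits among positions is
counting elements by their key bit. -/
theorem count_roundBits {x : ℕ} (hx : x ≤ n) (c : Bool) :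
    Nat.count (Hit n (roundBits S j) c) x =
      (Finset.univ.filter fun u => pos S j u < x ∧ (S u).testBit j = c).card := by
  rw [Nat.count_eq_card_filter_range, ← Finset.card_image_of_injective _ (pos_injective S j)]
  congr 1
  ext y
  simp only [Finset.mem_filter, Finset.mem_range, Finset.mem_image, Finset.mem_univ, true_and]
  constructor
  · rintro ⟨hy, h⟩
    obtain ⟨u, rfl⟩ := exists_pos_eq S j (hy.trans_le hx)
    rw [Hit, or_iff_right (by omega), roundBits_pos] at h
    exact ⟨u, ⟨hy, h⟩, rfl⟩
  · rintro ⟨u, ⟨hy, h⟩, rfl⟩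
    exact ⟨hy, Or.inr (by rw [roundBits_pos, h])⟩

theorem count_false_add_count_true (v : ℕ → Bool) {x : ℕ} (hx : x ≤ n) :
    Nat.count (Hit n v false) x + Nat.count (Hit n v true) x = x := by
  induction x with
  | zero => simp
  | succ x ih =>
    have := ih (by omega)
    have e : ∀ c, Hit n v c x ↔ v x = c := fun c => or_iff_right (by omega)
    rw [Nat.count_succ, Nat.count_succ]
    simp only [e]
    cases v x <;> simp <;> omega

/-- Passing to the next round adds bit `j` with weight `2 ^ j * n`, which exceeds every earlier key.
So the new order compares bit `j` first and then the old order: a stable partition. -/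
theorem sortKey_succ_lt {u v : Fin n} : sortKey S (j + 1) u < sortKey S (j + 1) v ↔
    ((S u).testBit j = false ∧ (S v).testBit j = true) ∨
      ((S u).testBit j = (S v).testBit j ∧ sortKey S j u < sortKey S j v) := by
  have hlt : ∀ u : Fin n, sortKey S j u < 2 ^ j * n := by
    intro u
    have h1 : S u % 2 ^ j < 2 ^ j := Nat.mod_lt _ (by positivity)
    have h2 := u.2
    rw [sortKey]
    nlinarith
  have hsucc : ∀ u : Fin n,
      sortKey S (j + 1) u = sortKey S j u + 2 ^ j * n * ((S u).testBit j).toNat := by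
    intro u
    rw [sortKey, sortKey, Nat.mod_pow_succ, Nat.toNat_testBit]
    ring
  have hu := hlt u
  have hv := hlt v
  rw [hsucc, hsucc]
  cases (S u).testBit j <;> cases (S v).testBit j <;> simp <;> omega

theorem pos_succ_of_false {v : Fin n} (h : (S v).testBit j = false) :
    pos S (j + 1) v = Nat.count (Hit n (roundBits S j) false) (pos S j v) := by
  rw [count_roundBits S j (pos_lt S j v).le, pos]
  congr 1
  ext u
  simp only [Finset.mem_filter, Finset.mem_univ, true_and, sortKey_succ_lt, pos_lt_pos, h]
  simp [and_comm]

/-- After the partition an element with bit one is preceded by all elements with bit zero and by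
those with bit one that preceded it before. -/
theorem pos_succ_of_true {v : Fin n} (h : (S v).testBit j = true) :
    pos S (j + 1) v = Nat.count (Hit n (roundBits S j) false) n +
      Nat.count (Hit n (roundBits S j) true) (pos S j v) := by
  rw [count_roundBits S j (pos_lt S j v).le, count_roundBits S j le_rfl, pos,
    ← Finset.card_union_of_disjoint]
  · congr 1
    ext u
    simp only [Finset.mem_filter, Finset.mem_univ, true_and, sortKey_succ_lt, pos_lt_pos, h,
      Finset.mem_union, pos_lt]
    simp [and_comm]
  · rw [Finset.disjoint_filter]
    rintro u - ⟨-, h1⟩ ⟨-, h2⟩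
    rw [h1] at h2
    exact absurd h2 (by decide)

/-- One round of the radix sort by rank queries. -/
theorem pos_succ (v : Fin n) :
    pos S (j + 1) v = if roundBits S j (pos S j v) = true
      then n - query n (roundBits S j) 2 n + query n (roundBits S j) 2 (pos S j v)
      else pos S j v - query n (roundBits S j) 2 (pos S j v) := by
  have h1 := count_false_add_count_true (roundBits S j) (le_refl n)
  have h2 := count_false_add_count_true (roundBits S j) (pos_lt S j v).le
  rw [roundBits_pos]
  simp only [query, if_true]
  split_ifs with h
  · rw [pos_succ_of_true S j h]; omega
  · rw [pos_succ_of_false S j (by simpa using h)]; omega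

/-- One round of the radix sort is undone by a select query. -/
theorem pos_eq_query (v : Fin n) :
    pos S j v = if pos S (j + 1) v < n - query n (roundBits S j) 2 n
      then query n (roundBits S j) 0 (pos S (j + 1) v)
      else query n (roundBits S j) 1
        (pos S (j + 1) v - (n - query n (roundBits S j) 2 n)) := by
  have h1 := count_false_add_count_true (roundBits S j) (le_refl n)
  have h2 := pos_lt S j v
  cases h : (S v).testBit j
  · have hit : Hit n (roundBits S j) false (pos S j v) := Or.inr (by rw [roundBits_pos, h])
    have h3 := Nat.count_strict_mono hit h2
    -- The new position is a number of hits before the old position, which is itself a hit; so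
    -- `Nat.nth` inverts it. The comparison with the number of zeros reveals the bit.
    rw [if_pos, pos_succ_of_false S j h]
    · simp only [query, OfNat.zero_ne_ofNat, if_false, zero_ne_one, decide_false]
      exact (Nat.nth_count hit).symm
    · rw [pos_succ_of_false S j h]
      simp only [query, if_true]
      omega
  · have hit : Hit n (roundBits S j) true (pos S j v) := Or.inr (by rw [roundBits_pos, h])
    have e : pos S (j + 1) v - (n - query n (roundBits S j) 2 n) =
        Nat.count (Hit n (roundBits S j) true) (pos S j v) := by
      rw [pos_succ_of_true S j h]
      simp only [query, if_true]
      omega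
    rw [if_neg, e]
    · simp only [query, OfNat.one_ne_ofNat, if_false, decide_true]
      exact (Nat.nth_count hit).symm
    · rw [pos_succ_of_true S j h]
      simp only [query, if_true]
      omega

theorem pos_zero (v : Fin n) : pos S 0 v = v := by
  simp only [pos, sortKey, pow_zero, Nat.mod_one, zero_mul, zero_add, Fin.val_fin_lt]
  rw [← Fin.card_Iio]
  congr 1
  ext u
  simp

end Radix

/-! ### The runs of a permutation as sorting keys -/

section Runs

variable {n : ℕ} (π : Equiv.Perm (Fin n))

/-- The number of the run that contains position `i`. -/
def runIndex (i : Fin n) : ℕ := ((downSteps π).filter (· < i)).card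

theorem runIndex_mono : Monotone (runIndex π) := fun i j h =>
  Finset.card_le_card fun x hx => by
    simp only [Finset.mem_filter] at hx ⊢
    exact ⟨hx.1, hx.2.trans_le h⟩

theorem runIndex_lt (i : Fin n) : runIndex π i < numRuns π :=
  Nat.lt_succ_of_le (Finset.card_le_card (Finset.filter_subset _ _))

/-- By induction on the distance: a descent between neighbouring positions would be a down step and
raise the run number strictly. -/
theorem lt_of_runIndex_eq {i j : Fin n} (hij : i < j) (h : runIndex π i = runIndex π j) :
    π i < π j := by
  have key : ∀ d : ℕ, ∀ j : Fin n, (j : ℕ) = i + d + 1 → runIndex π i = runIndex π j →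
      π i < π j := by
    intro d
    induction d with
    | zero =>
      intro j hj h
      by_contra hlt
      have hne : π j ≠ π i := fun e => by
        have := congrArg Fin.val (π.injective e)
        omega
      have hi : i ∈ downSteps π := by
        simp only [downSteps, Finset.mem_filter, Finset.mem_univ, true_and]
        have e : (⟨(i : ℕ) + 1, by omega⟩ : Fin n) = j := Fin.ext hj.symm
        exact ⟨by omega, by rw [e]; exact lt_of_le_of_ne (not_lt.1 hlt) hne⟩
      have : runIndex π i < runIndex π j := by
        refine Finset.card_lt_card (Finset.ssubset_iff_of_subset ?_ |>.2 ⟨i, ?_, ?_⟩)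
        · intro x hx
          simp only [Finset.mem_filter] at hx ⊢
          exact ⟨hx.1, hx.2.trans (by rw [Fin.lt_def]; omega)⟩
        · simp only [Finset.mem_filter]
          exact ⟨hi, by rw [Fin.lt_def]; omega⟩
        · simp
      omega
    | succ d ih =>
      intro j hj h
      have h1 : (⟨i + d + 1, by omega⟩ : Fin n) < j := by rw [Fin.lt_def]; simp only; omega
      have h2 : i < (⟨i + d + 1, by omega⟩ : Fin n) := by rw [Fin.lt_def]; simp
      have h3 := runIndex_mono π h1.le
      have h4 := runIndex_mono π h2.le
      have h5 := ih ⟨i + d + 1, by omega⟩ rfl (by omega)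
      refine h5.trans ?_
      by_contra hlt
      have hne : π j ≠ π ⟨i + d + 1, by omega⟩ := fun e => h1.ne' (π.injective e)
      have hi : (⟨i + d + 1, by omega⟩ : Fin n) ∈ downSteps π := by
        simp only [downSteps, Finset.mem_filter, Finset.mem_univ, true_and]
        have e : (⟨(i + d + 1 : ℕ) + 1, by omega⟩ : Fin n) = j := Fin.ext hj.symm
        exact ⟨by omega, by rw [e]; exact lt_of_le_of_ne (not_lt.1 hlt) hne⟩
      have : runIndex π ⟨i + d + 1, by omega⟩ < runIndex π j := by
        refine Finset.card_lt_card (Finset.ssubset_iff_of_subset ?_ |>.2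
          ⟨⟨i + d + 1, by omega⟩, ?_, ?_⟩)
        · intro x hx
          simp only [Finset.mem_filter] at hx ⊢
          exact ⟨hx.1, hx.2.trans h1⟩
        · simp only [Finset.mem_filter]
          exact ⟨hi, h1⟩
        · simp
      omega
  have := Fin.lt_def.1 hij
  exact key (j - i - 1) j (by omega) h

theorem inv_apply_apply (i : Fin n) : π⁻¹ (π i) = i := π.symm_apply_apply i

/-- After sorting by run numbers, every value is at its position in the permutation. -/
theorem pos_runIndex {h : ℕ} (hh : numRuns π ≤ 2 ^ h) (v : Fin n) :
    pos (fun v => runIndex π (π⁻¹ v)) h v = (π⁻¹ v : Fin n) := by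
  have hS : ∀ i, runIndex π i % 2 ^ h = runIndex π i := fun i =>
    Nat.mod_eq_of_lt ((runIndex_lt π i).trans_le hh)
  -- The final keys of the values are ordered like their positions: by the run number between runs,
  -- by the value within a run. Hence the rank of `π i` is the number of positions before `i`.
  have hlt : ∀ i j : Fin n, i < j →
      sortKey (fun v => runIndex π (π⁻¹ v)) h (π i) <
        sortKey (fun v => runIndex π (π⁻¹ v)) h (π j) := by
    intro i j hij
    simp only [sortKey, inv_apply_apply, hS]
    rcases (runIndex_mono π hij.le).lt_or_eq with h1 | h1
    · have := (π i).2
      nlinarith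
    · have := Fin.lt_def.1 (lt_of_runIndex_eq π hij h1)
      rw [h1]
      omega
  obtain ⟨i, rfl⟩ := π.surjective v
  rw [pos, inv_apply_apply, ← Fin.card_Iio,
    ← Finset.card_image_of_injective (Finset.Iio i) π.injective]
  congr 1
  ext u
  obtain ⟨k, rfl⟩ := π.surjective u
  simp only [Finset.mem_filter, Finset.mem_univ, true_and, Finset.mem_image, Finset.mem_Iio,
    EmbeddingLike.apply_eq_iff_eq, exists_eq_right]
  refine ⟨fun hki => ?_, hlt k i⟩
  by_contra hik
  rcases (not_lt.1 hik).lt_or_eq with h1 | h1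
  · exact absurd (hlt i k h1) (by omega)
  · rw [h1] at hki
    omega

/-- A permutation with one run is the identity. -/
theorem apply_eq_of_numRuns_eq_one (hπ : numRuns π = 1) (i : Fin n) : π i = i := by
  have h := pos_runIndex π (h := 0) (by simp [hπ]) (π i)
  rw [pos_zero, inv_apply_apply] at h
  exact Fin.ext h

end Runs

/-! ### The two programs -/

section Rounds

open SuccinctPerm.Expr Params

/-- Variable `0`, a position before round `var 2`, is replaced by the position after the round. -/
def sortRound : Assignments :=
  [(15, .const 2), (4, .var 0)] ++ queryCode ++ [(14, .var 13), (4, hdr 2)] ++ queryCode ++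
  [(0, .ite (.read (hdr 18 + .var 2 * hdr 2 + .var 0) (.const 1))
    (hdr 2 - .var 13 + .var 14) (.var 0 - .var 14))]

/-- Variable `0`, a position after round `var 2`, is replaced by the position before the round. -/
def unsortRound : Assignments :=
  [(15, .const 2), (4, hdr 2)] ++ queryCode ++
  [(14, hdr 2 - .var 13), (15, .const 1 - less (.var 0) (.var 14)),
    (4, .ite (less (.var 0) (.var 14)) (.var 0) (.var 0 - .var 14))] ++ queryCode ++
  [(0, .var 13)]

/-- The body of the loop for `π⁻¹`; variable `3` counts the remaining rounds. -/
def sortBody : Assignments := sortRound ++ [(2, .var 2 + .const 1), (3, .var 3 - .const 1)]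

/-- The body of the loop for `π`; variable `3` counts the remaining rounds. -/
def unsortBody : Assignments := [(3, .var 3 - .const 1), (2, .var 3)] ++ unsortRound

/-- The bound on the exponents of intermediate values. -/
def maxDeg : ℕ := 16

/-- The exponents of the bounds at the beginning of each round. -/
def initDeg (r : ℕ) : ℕ := if r < 4 then 1 else maxDeg

/-- The overflow analysis is a finite computation. Variables from `4` on are scratch and assigned
before they are read, so they may enter a round with the weakest bound. -/
theorem safe_sortBody : sortBody.safe maxDeg initDeg = true := by decide +kernel

theorem safe_unsortBody : unsortBody.safe maxDeg initDeg = true := by decide +kernel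

variable {p : Params} {bit : ℕ → ℕ → Bool} {env : ℕ → ℕ} {j : ℕ}

theorem queryCode_run_of_notMem (bits : List Bool) (env : ℕ → ℕ) {r : ℕ}
    (h : r ∉ [5, 6, 7, 8, 9, 10, 11, 12, 13]) : queryCode.run bits env r = env r :=
  Assignments.run_of_notMem _ _ h

theorem ok_sortRound (hp : p.Valid) (h1 : env 1 = p.lam) :
    sortRound.ok (p.encoding bit) p.lam env := by
  have hlam := hp.six_le_lam
  simp [sortRound, Assignments.ok_append, Assignments.ok,
    queryCode_run_of_notMem, ok_queryCode hp, h1, Expr.ok, ok_hdr, ok_sub, Expr.val]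
  omega

theorem ok_unsortRound (hp : p.Valid) (h1 : env 1 = p.lam) :
    unsortRound.ok (p.encoding bit) p.lam env := by
  simp [unsortRound, Assignments.ok_append, Assignments.ok,
    queryCode_run_of_notMem, ok_queryCode hp, h1, Expr.ok, ok_hdr, ok_sub, ok_less]

theorem run_sortRound (hp : p.Valid) (h1 : env 1 = p.lam) (h2 : env 2 = j) (hj : j < p.h)
    (h0 : env 0 < p.n) : sortRound.run (p.encoding bit) env 0 =
      if bit j (env 0) = true then p.n - query p.n (bit j) 2 p.n + query p.n (bit j) 2 (env 0)
        else env 0 - query p.n (bit j) 2 (env 0) := by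
  have hbit : readBits (p.encoding bit) (p.oBits + j * p.n + env 0) 1 = (bit j (env 0)).toNat := by
    have h3 := p.testBit_window bit (t := 0) (l := 1) hj h0 one_pos
    have h4 := readBits_lt (p.encoding bit) (p.oBits + j * p.n + env 0) 1
    rw [Nat.testBit_zero, add_zero] at h3
    rw [← h3]
    interval_cases readBits (p.encoding bit) (p.oBits + j * p.n + env 0) 1 <;> rfl
  obtain ⟨env1, he1⟩ : ∃ env1, env1 = Assignments.run (p.encoding bit)
    [(15, .const 2), (4, .var 0)] env := ⟨_, rfl⟩
  obtain ⟨env2, he2⟩ : ∃ env2, env2 = Assignments.run (p.encoding bit)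
    [(14, .var 13), (4, hdr 2)] (queryCode.run (p.encoding bit) env1) := ⟨_, rfl⟩
  have q1 : queryCode.run (p.encoding bit) env1 13 = query p.n (bit j) 2 (env 0) := by
    refine run_queryCode hp ?_ ?_ ?_ ?_ hj (by norm_num) h0.le (Or.inl rfl) <;>
      simp [he1, Assignments.run, h1, h2, Expr.val]
  have q2 : queryCode.run (p.encoding bit) env2 13 = query p.n (bit j) 2 p.n := by
    refine run_queryCode hp ?_ ?_ ?_ ?_ hj (by norm_num) le_rfl (Or.inl rfl) <;>
      simp [he1, he2, Assignments.run, h1, h2, Expr.val, queryCode_run_of_notMem, val_hdr hp,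
        header_two]
  simp only [sortRound, Assignments.run_append, ← he1, ← he2]
  have h14 : env2 14 = query p.n (bit j) 2 (env 0) := by
    simp [he2, Assignments.run, Expr.val, q1]
  have r0 : env2 0 = env 0 := by
    simp [he1, he2, Assignments.run, queryCode_run_of_notMem]
  have r1 : env2 1 = p.lam := by
    simp [he1, he2, Assignments.run, queryCode_run_of_notMem, h1]
  have r2 : env2 2 = j := by
    simp [he1, he2, Assignments.run, queryCode_run_of_notMem, h2]
  simp [Assignments.run, Expr.val, val_sub, queryCode_run_of_notMem, q2, h14, r0, r1, r2,
    val_hdr hp, header_two, header_eighteen, ArithOp.eval, hbit]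

/-- The condition `hlt` keeps select away from the padding, where the windows say nothing; it is met
because the answer is a position of an earlier round. -/
theorem run_unsortRound (hp : p.Valid) (h1 : env 1 = p.lam) (h2 : env 2 = j) (hj : j < p.h)
    (h0 : env 0 < p.n)
    (hlt : (if env 0 < p.n - query p.n (bit j) 2 p.n then query p.n (bit j) 0 (env 0)
        else query p.n (bit j) 1 (env 0 - (p.n - query p.n (bit j) 2 p.n))) < p.n) :
    unsortRound.run (p.encoding bit) env 0 =
      if env 0 < p.n - query p.n (bit j) 2 p.n then query p.n (bit j) 0 (env 0)
        else query p.n (bit j) 1 (env 0 - (p.n - query p.n (bit j) 2 p.n)) := by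
  obtain ⟨z, hz⟩ : ∃ z, z = p.n - query p.n (bit j) 2 p.n := ⟨_, rfl⟩
  obtain ⟨env1, he1⟩ : ∃ env1, env1 = Assignments.run (p.encoding bit)
    [(15, .const 2), (4, hdr 2)] env := ⟨_, rfl⟩
  obtain ⟨env2, he2⟩ : ∃ env2, env2 = Assignments.run (p.encoding bit)
    [(14, hdr 2 - .var 13), (15, .const 1 - less (.var 0) (.var 14)),
    (4, .ite (less (.var 0) (.var 14)) (.var 0) (.var 0 - .var 14))]
    (queryCode.run (p.encoding bit) env1) := ⟨_, rfl⟩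
  have q1 : queryCode.run (p.encoding bit) env1 13 = query p.n (bit j) 2 p.n := by
    refine run_queryCode hp ?_ ?_ ?_ ?_ hj (by norm_num) le_rfl (Or.inl rfl) <;>
      simp [he1, Assignments.run, h1, h2, Expr.val, val_hdr hp, header_two]
  have r1 : env2 1 = p.lam := by
    simp [he1, he2, Assignments.run, queryCode_run_of_notMem, h1]
  have r2 : env2 2 = j := by
    simp [he1, he2, Assignments.run, queryCode_run_of_notMem, h2]
  have e1 : queryCode.run (p.encoding bit) env1 0 = env 0 := by
    simp [he1, Assignments.run, queryCode_run_of_notMem]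
  have e2 : queryCode.run (p.encoding bit) env1 1 = p.lam := by
    simp [he1, Assignments.run, queryCode_run_of_notMem, h1]
  have r4 : env2 4 = if env 0 < z then env 0 else env 0 - z := by
    simp [he2, Assignments.run, Expr.val, val_sub, val_less, q1, e1, e2, val_hdr hp,
      header_two, ← hz]
  have r15 : env2 15 = if env 0 < z then 0 else 1 := by
    simp [he2, Assignments.run, Expr.val, val_sub, val_less, q1, e1, e2, val_hdr hp,
      header_two, ← hz]
    split <;> rfl
  have key : queryCode.run (p.encoding bit) env2 13 =
      if env 0 < z then query p.n (bit j) 0 (env 0) else query p.n (bit j) 1 (env 0 - z) := by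
    rw [← hz] at hlt
    split_ifs at hlt r4 r15 ⊢ with hc
    · exact run_queryCode hp r1 r2 r4 r15 hj (by norm_num) h0.le (Or.inr hlt)
    · exact run_queryCode hp r1 r2 r4 r15 hj (by norm_num) (by omega) (Or.inr hlt)
  simp only [unsortRound, Assignments.run_append, ← he1, ← he2]
  simp [Assignments.run, Expr.val, key, ← hz]

theorem sortRound_run_of_notMem (bits : List Bool) (env : ℕ → ℕ) {r : ℕ}
    (h : r ∉ [0, 4, 5, 6, 7, 8, 9, 10, 11, 12, 13, 14, 15]) : sortRound.run bits env r = env r :=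
  Assignments.run_of_notMem _ _ fun h' => h (by
    simp only [sortRound, queryCode, List.map_append, List.map_cons, List.map_nil, List.mem_append,
      List.mem_cons, List.not_mem_nil] at h' ⊢
    tauto)

theorem unsortRound_run_of_notMem (bits : List Bool) (env : ℕ → ℕ) {r : ℕ}
    (h : r ∉ [0, 4, 5, 6, 7, 8, 9, 10, 11, 12, 13, 14, 15]) : unsortRound.run bits env r = env r :=
  Assignments.run_of_notMem _ _ fun h' => h (by
    simp only [unsortRound, queryCode, List.map_append, List.map_cons, List.map_nil,
      List.mem_append, List.mem_cons, List.not_mem_nil] at h' ⊢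
    tauto)

end Rounds

/-! ### Start-up -/

/-- If the low bits of `x` are a zero above `m` ones, adding one flips exactly these `m + 1` bits,
and the carry stops at the zero. -/
theorem xor_succ_add_one {x m : ℕ} (h : x % 2 ^ (m + 1) = 2 ^ m - 1) :
    (x ^^^ (x + 1)) + 1 = 2 ^ (m + 1) := by
  have hm : 0 < 2 ^ m := by positivity
  have hs : 2 ^ (m + 1) = 2 * 2 ^ m := by ring
  have h1 := Nat.div_add_mod x (2 ^ (m + 1))
  rw [h] at h1
  have h2 : x + 1 = 2 ^ (m + 1) * (x / 2 ^ (m + 1)) + 2 ^ m := by omega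
  have h3 : (x + 1) / 2 ^ (m + 1) = x / 2 ^ (m + 1) := by
    rw [h2, Nat.mul_add_div (by omega), show 2 ^ m / 2 ^ (m + 1) = 0 from
      Nat.div_eq_of_lt (by omega), add_zero]
  have h4 : (x + 1) % 2 ^ (m + 1) = 2 ^ m := by
    rw [h2, Nat.mul_add_mod, Nat.mod_eq_of_lt (by omega)]
  have h5 := Nat.xor_div_two_pow (a := x) (b := x + 1) (n := m + 1)
  have h6 := Nat.xor_mod_two_pow (a := x) (b := x + 1) (n := m + 1)
  rw [h3, Nat.xor_self] at h5
  rw [h, h4] at h6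
  have h7 : (2 ^ m - 1) ^^^ 2 ^ m = 2 ^ (m + 1) - 1 := by
    refine Nat.eq_of_testBit_eq fun k => ?_
    rw [Nat.testBit_xor, Nat.testBit_two_pow_sub_one, Nat.testBit_two_pow_sub_one,
      Nat.testBit_two_pow, Bool.eq_iff_iff]
    simp only [bne_iff_ne, ne_eq, decide_eq_decide, decide_eq_true_eq]
    omega
  have h8 := Nat.div_add_mod (x ^^^ (x + 1)) (2 ^ (m + 1))
  rw [h5, h6, h7] at h8
  omega

/-- Before the loop, the input becomes zero-based, and variable `3` is the number of rounds. -/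
def prelude : Assignments := [(0, .var 0 - .const 1), (3, Expr.hdr 3)]

/-- After the loop, the output becomes one-based. -/
def postlude : Assignments := [(0, .var 0 + .const 1)]

theorem safe_prelude : prelude.safe maxDeg initDeg = true := by decide +kernel

theorem safe_postlude : postlude.safe maxDeg initDeg = true := by decide +kernel

/-- From the first word of the bit string, the width of absolute values is computed into
register `1`. An empty bit string represents the identity. -/
def mainCode (body : Assignments) : Program :=
  .seq (.const 16 0) <| .seq (.loadData 17 16) <| .ite 17
    (.seq (.const 18 1) <| .seq (.op .add 19 17 18) <| .seq (.op .xor 19 17 19) <|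
      .seq (.op .add 19 19 18) <| .seq (.op .div 20 17 19) <| .seq (.op .mod 1 20 19) <|
      .seq prelude.compile <| .seq (.loop 3 body.compile) postlude.compile)
    .skip

/-- The bound on the running time of `mainCode` with `h` rounds. -/
def mainCost (body : Assignments) (h : ℕ) : ℕ :=
  12 + prelude.cost + h * (body.cost + 1) + postlude.cost

theorem computes_mainCode_nil {w : ℕ} (body : Assignments) (input : ℕ) :
    Computes (dataWord w []) (mainCode body) (State.init w input) (mainCost body 0) fun s =>
      s.reg 0 = BitVec.ofNat w input := by
  -- The summand `0` is the budget of the branch that is not taken: the empty string yields a zero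
  -- first word, which no valid encoding does.
  refine Computes.mono (T := 1 + (1 + (0 + 1 + 1))) ?_
    (by simp only [mainCost]; omega) fun _ h => h
  refine .seq (.const rfl) ?_; rintro _ rfl
  refine .seq (.loadData rfl) ?_; rintro _ rfl
  have h0 (a : BitVec w) : dataWord w [] a = 0#w := by
    refine BitVec.eq_of_getLsbD_eq fun i hi => ?_
    simp [dataWord, BitVec.getLsbD_ofFnLE]
  refine .ite (fun h => absurd ?_ h) fun _ => .skip ?_
  · simp [h0]
  · simp [State.init]

/-- What the start-up code computes from the first word of the encoding. -/
theorem first_word {w : ℕ} {p : Params} (hp : p.Valid) (bit : ℕ → ℕ → Bool)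
    (hw : 16 * p.lam < w) {X : BitVec w}
    (hX : X = dataWord w (p.encoding bit) (BitVec.ofNat w 0)) :
    X ≠ 0#w ∧ ((X ^^^ (X + BitVec.ofNat w 1)) + BitVec.ofNat w 1).toNat = 2 ^ p.lam ∧
      X.toNat / 2 ^ p.lam % 2 ^ p.lam = p.lam := by
  have hlam := hp.six_le_lam
  have hPw : 2 ^ p.lam < 2 ^ w := Nat.pow_lt_pow_right (by norm_num) (by omega)
  have hXr : X.toNat = readBits (p.encoding bit) 0 w := by
    rw [hX, dataWord, readBits]; simp
  have hX0 : X.toNat % 2 ^ p.lam = 2 ^ (p.lam - 1) - 1 := by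
    rw [hXr, readBits_mod _ _ (by omega), ← Nat.zero_mul p.lam,
      p.readBits_header bit (by norm_num), Nat.mod_eq_of_lt (hp.header_lt (by norm_num))]
    rfl
  have hX1 : X.toNat / 2 ^ p.lam % 2 ^ p.lam = p.lam := by
    rw [hXr, show w = p.lam + (w - p.lam) by omega, readBits_div, readBits_mod _ _ (by omega),
      zero_add]
    have := p.readBits_header bit (i := 1) (by norm_num)
    rw [one_mul, Nat.mod_eq_of_lt (hp.header_lt (by norm_num))] at this
    exact this
  have hhalf : 2 ^ p.lam = 2 * 2 ^ (p.lam - 1) := by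
    rw [← pow_succ', Nat.sub_add_cancel (by omega)]
  have hhalf2 : 2 ^ 5 ≤ 2 ^ (p.lam - 1) := Nat.pow_le_pow_right (by norm_num) (by omega)
  have hXne : X ≠ 0#w := by
    rintro rfl
    rw [BitVec.toNat_ofNat, Nat.zero_mod, Nat.zero_mod] at hX0
    omega
  have h1w : (BitVec.ofNat w 1).toNat = 1 := by
    rw [BitVec.toNat_ofNat, Nat.mod_eq_of_lt (by omega)]
  -- If `X + 1` wrapped, it would be divisible by `2 ^ lam`, but its residue is `2 ^ (lam - 1)`.
  have hXlt : X.toNat + 1 < 2 ^ w := by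
    refine lt_of_le_of_ne X.isLt fun h => ?_
    have h2 : (X.toNat + 1) % 2 ^ p.lam = 0 := by
      rw [h]
      exact Nat.mod_eq_zero_of_dvd (pow_dvd_pow _ (by omega))
    have h3 := Nat.div_add_mod X.toNat (2 ^ p.lam)
    rw [hX0] at h3
    rw [← h3, add_assoc, Nat.mul_add_mod, Nat.mod_eq_of_lt (by omega)] at h2
    omega
  have hP : ((X ^^^ (X + BitVec.ofNat w 1)) + BitVec.ofNat w 1).toNat = 2 ^ p.lam := by
    have h2 : (X + BitVec.ofNat w 1).toNat = X.toNat + 1 := by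
      rw [BitVec.toNat_add_of_lt (by rw [h1w]; exact hXlt), h1w]
    have h3 := xor_succ_add_one (x := X.toNat) (m := p.lam - 1)
      (by rw [Nat.sub_add_cancel (by omega)]; exact hX0)
    rw [Nat.sub_add_cancel (by omega)] at h3
    have h4 : (X ^^^ (X + BitVec.ofNat w 1)).toNat + 1 = 2 ^ p.lam := by
      rw [BitVec.toNat_xor, h2, h3]
    rw [BitVec.toNat_add_of_lt (by rw [h1w, h4]; exact hPw), h1w, h4]
  exact ⟨hXne, hP, hX1⟩

/-- A round of `body` maintains the relation `J` between the number of remaining rounds and the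
variables `0` and `2`. -/
theorem computes_mainCode {w : ℕ} {p : Params} (hp : p.Valid) {bit : ℕ → ℕ → Bool}
    (hw : maxDeg * p.lam < w) {body : Assignments} (hsafe : body.safe maxDeg initDeg = true)
    {J : ℕ → ℕ → ℕ → Prop} {x y : ℕ} (hx : x < p.n)
    (hJ : ∀ k a b, J k a b → k ≤ p.h ∧ a < p.n ∧ b ≤ p.h)
    (hstart : J p.h x 0) (hend : ∀ a b, J 0 a b → a = y)
    (hstep : ∀ k (env : ℕ → ℕ), env 1 = p.lam → env 3 = k + 1 → J (k + 1) (env 0) (env 2) →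
      body.ok (p.encoding bit) p.lam env ∧ body.run (p.encoding bit) env 1 = p.lam ∧
      body.run (p.encoding bit) env 3 = k ∧
      J k (body.run (p.encoding bit) env 0) (body.run (p.encoding bit) env 2)) :
    Computes (dataWord w (p.encoding bit)) (mainCode body) (State.init w (x + 1))
      (mainCost body p.h) fun s => (s.reg 0).toNat = y + 1 := by
  have hlam := hp.six_le_lam
  have hK : 1 ≤ maxDeg := by decide
  have hlw : 16 * p.lam < w := hw
  have hPw : 2 ^ p.lam < 2 ^ w := Nat.pow_lt_pow_right (by norm_num) (by omega)
  have hn := hp.two_mul_n_lt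
  have hhP : p.h < 2 ^ p.lam := hp.header_lt (i := 3) (by norm_num)
  have hlP : p.lam < 2 ^ p.lam := Nat.lt_two_pow_self
  have hPK : 2 ^ p.lam ≤ (2 ^ p.lam) ^ maxDeg := Nat.le_self_pow (by decide) _
  have hδK : ∀ r, initDeg r ≤ maxDeg := fun r => by rw [initDeg]; split_ifs <;> decide
  -- the bounds at the beginning of each round
  have hbound : ∀ env : ℕ → ℕ, (∀ r < numVars, env r < (2 ^ p.lam) ^ maxDeg) →
      (∀ r < 4, env r < 2 ^ p.lam) → ∀ r < numVars, env r < (2 ^ p.lam) ^ initDeg r := by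
    intro env h1 h2 r hr
    rw [initDeg]
    split_ifs with h
    · rw [pow_one]; exact h2 r h
    · exact h1 r hr
  obtain ⟨X, hX⟩ : ∃ X, X = dataWord w (p.encoding bit) (BitVec.ofNat w 0) := ⟨_, rfl⟩
  obtain ⟨hXne, hP, hX1⟩ := first_word hp bit hlw hX
  refine Computes.mono (T := 1 + (1 + ((1 + (1 + (1 + (1 + (1 + (1 + (prelude.cost +
    ((p.h * (body.cost + 1) + 1) + postlude.cost))))))))+ 1 + 1))) ?_
    (by simp only [mainCost]; omega) fun _ h => h
  refine .seq (.const rfl) ?_; rintro _ rfl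
  refine .seq (.loadData rfl) ?_; rintro _ rfl
  refine .ite (fun _ => ?_) fun h => absurd ?_ hXne
  swap
  · simpa [hX] using h
  refine .seq (.const rfl) ?_; rintro _ rfl
  refine .seq (.op rfl) ?_; rintro _ rfl
  refine .seq (.op rfl) ?_; rintro _ rfl
  refine .seq (.op rfl) ?_; rintro _ rfl
  refine .seq (.op rfl) ?_; rintro _ rfl
  refine .seq (.op (Q := fun s => ∀ r < numVars, (s.reg r).toNat =
    if r = 0 then x + 1 else if r = 1 then p.lam else 0) ?_) ?_
  · intro r hr
    have hr' : r < 16 := hr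
    have hx1 : x + 1 < 2 ^ w := by omega
    by_cases hr1 : r = 1
    · subst hr1
      simp only [State.setReg_reg, if_true, WordOp.eval, Nat.reduceEqDiff, if_false, ← hX]
      rw [BitVec.toNat_umod, BitVec.toNat_udiv, hP, hX1]
    · simp only [State.setReg_reg, hr1, show r ≠ 16 by omega, show r ≠ 17 by omega,
        show r ≠ 18 by omega, show r ≠ 19 by omega, show r ≠ 20 by omega, if_false, State.init,
        Function.update_apply]
      split_ifs
      · rw [BitVec.toNat_ofNat, Nat.mod_eq_of_lt hx1]
      · simp
  intro s1 hs1
  have hlow : ∀ r < 4, (if r = 0 then x + 1 else if r = 1 then p.lam else 0) < 2 ^ p.lam := by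
    intro r _
    split_ifs <;> omega
  refine .seq (prelude.computes_compile hlam hK hw (δ := initDeg) (bits := p.encoding bit)
    (env := fun r => if r = 0 then x + 1 else if r = 1 then p.lam else 0)
    (hbound _ (fun r hr => ?_) hlow) hδK safe_prelude ?_ s1 hs1) fun s2 hs2 => ?_
  · refine lt_of_lt_of_le ?_ hPK
    split_ifs <;> omega
  · simp [prelude, Assignments.ok, Expr.ok, Expr.ok_sub, Expr.ok_hdr]
  refine .seq (.loop (I := fun k s => (∀ r < numVars, (s.reg r).toNat < (2 ^ p.lam) ^ maxDeg) ∧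
    (s.reg 1).toNat = p.lam ∧ (s.reg 3).toNat = k ∧ J k (s.reg 0).toNat (s.reg 2).toNat)
    ?_ ?_ p.h s2 ?_) ?_
  · rintro s ⟨-, -, h3, -⟩
    exact BitVec.eq_of_toNat_eq (by rw [h3]; simp)
  · rintro k s ⟨hb, h1, h3, h02⟩
    obtain ⟨h5, h6, h7⟩ := hJ _ _ _ h02
    obtain ⟨hok, hr1, hr3, hr02⟩ := hstep k (fun r => (s.reg r).toNat) h1 h3 h02
    refine ⟨fun h => ?_, ?_⟩
    · rw [h, BitVec.toNat_ofNat, Nat.zero_mod] at h3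
      omega
    refine (body.computes_compile hlam hK hw (hbound _ hb ?_) hδK hsafe hok s
      fun _ _ => rfl).mono le_rfl fun s' hs' => ?_
    · intro r hr
      interval_cases r <;> omega
    · have e (r : ℕ) (hr : r < 16) := (hs' r hr).1
      refine ⟨fun r hr => by rw [e r hr]; exact (hs' r hr).2, ?_, ?_, ?_⟩
      · rw [e 1 (by norm_num), hr1]
      · rw [e 3 (by norm_num), hr3]
      · rw [e 0 (by norm_num), e 2 (by norm_num)]
        exact hr02
  · have e (r : ℕ) (hr : r < 16) := (hs2 r hr).1
    refine ⟨fun r hr => by rw [e r hr]; exact (hs2 r hr).2, ?_, ?_, ?_⟩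
    · rw [e 1 (by norm_num)]
      simp [prelude, Assignments.run]
    · rw [e 3 (by norm_num)]
      simp [prelude, Assignments.run, Expr.val_hdr hp, Params.header_three]
    · rw [e 0 (by norm_num), e 2 (by norm_num)]
      simpa [prelude, Assignments.run, Expr.val, Expr.val_sub] using hstart
  · rintro s3 ⟨hb, h1, h3, h02⟩
    obtain ⟨-, h6, h7⟩ := hJ _ _ _ h02
    refine (postlude.computes_compile (bits := p.encoding bit) hlam hK hw
      (hbound (fun r => (s3.reg r).toNat) hb ?_) hδK safe_postlude ?_ s3
      fun _ _ => rfl).mono le_rfl fun s' hs' => ?_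
    · intro r hr
      interval_cases r <;> omega
    · simp [postlude, Assignments.ok, Expr.ok]
    · rw [(hs' 0 (by decide)).1, ← hend _ _ h02]
      simp [postlude, Assignments.run, Expr.val, ArithOp.eval]

theorem computes_sort {p : Params} (hp : p.Valid) (S : Fin p.n → ℕ) {w : ℕ}
    (hw : maxDeg * p.lam < w) (v : Fin p.n) :
    Computes (dataWord w (p.encoding (roundBits S))) (mainCode sortBody) (State.init w (v + 1))
      (mainCost sortBody p.h) fun s => (s.reg 0).toNat = pos S p.h v + 1 := by
  refine computes_mainCode hp hw safe_sortBody
    -- With `k` rounds left, `h - k` rounds of the sort have been followed.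
    (J := fun k a b => a = pos S (p.h - k) v ∧ b = p.h - k ∧ k ≤ p.h) v.2 ?_ ?_ ?_ ?_
  · rintro k a b ⟨rfl, rfl, h⟩
    exact ⟨h, pos_lt _ _ _, by omega⟩
  · simp [pos_zero]
  · rintro a b ⟨rfl, -⟩
    rw [Nat.sub_zero]
  · rintro k env h1 h3 ⟨h0, h2, hk⟩
    have hr := run_sortRound (bit := roundBits S) hp h1 h2 (by omega) (h0 ▸ pos_lt _ _ _)
    rw [h0, ← pos_succ] at hr
    have e : p.h - (k + 1) + 1 = p.h - k := by omega
    rw [e] at hr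
    have r1 := sortRound_run_of_notMem (p.encoding (roundBits S)) env (r := 1) (by decide)
    have r2 := sortRound_run_of_notMem (p.encoding (roundBits S)) env (r := 2) (by decide)
    have r3 := sortRound_run_of_notMem (p.encoding (roundBits S)) env (r := 3) (by decide)
    simp only [sortBody, Assignments.ok_append, Assignments.run_append]
    refine ⟨⟨ok_sortRound hp h1, ?_⟩, ?_, ?_, ?_, ?_, by omega⟩
    · simp [Assignments.ok, Expr.ok, Expr.ok_sub]
    · simp [Assignments.run, r1, h1]
    · simp [Assignments.run, Expr.val, Expr.val_sub, r3, h3]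
    · simp [Assignments.run, hr]
    · simp [Assignments.run, Expr.val, ArithOp.eval, r2, h2, e]

theorem computes_unsort {p : Params} (hp : p.Valid) (S : Fin p.n → ℕ) {w : ℕ}
    (hw : maxDeg * p.lam < w) (v : Fin p.n) :
    Computes (dataWord w (p.encoding (roundBits S))) (mainCode unsortBody)
      (State.init w (pos S p.h v + 1))
      (mainCost unsortBody p.h) fun s => (s.reg 0).toNat = v + 1 := by
  refine computes_mainCode hp hw safe_unsortBody
    -- Here `k` rounds are still to be undone. The round number in variable `2` is only bounded,
    -- since the body recomputes it from the counter.
    (J := fun k a b => a = pos S k v ∧ b ≤ p.h ∧ k ≤ p.h) (pos_lt _ _ _) ?_ ?_ ?_ ?_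
  · rintro k a b ⟨rfl, h, h'⟩
    exact ⟨h', pos_lt _ _ _, h⟩
  · simp
  · rintro a b ⟨rfl, -⟩
    rw [pos_zero]
  · rintro k env h1 h3 ⟨h0, h2, hk⟩
    obtain ⟨env1, he1⟩ : ∃ env1, env1 = Assignments.run (p.encoding (roundBits S))
      [(3, .var 3 - .const 1), (2, .var 3)] env := ⟨_, rfl⟩
    have a0 : env1 0 = pos S (k + 1) v := by simp [he1, Assignments.run, h0]
    have a1 : env1 1 = p.lam := by simp [he1, Assignments.run, h1]
    have a2 : env1 2 = k := by simp [he1, Assignments.run, Expr.val, Expr.val_sub, h3]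
    have a3 : env1 3 = k := by simp [he1, Assignments.run, Expr.val, Expr.val_sub, h3]
    have hq := pos_eq_query S k v
    rw [← a0] at hq
    have hr := run_unsortRound (bit := roundBits S) hp a1 a2 (by omega) (a0 ▸ pos_lt _ _ _)
      (hq ▸ pos_lt _ _ _)
    rw [← hq] at hr
    simp only [unsortBody, Assignments.ok_append, Assignments.run_append, ← he1]
    refine ⟨⟨?_, ok_unsortRound hp a1⟩, ?_, ?_, hr, ?_, by omega⟩
    · simp [Assignments.ok, Expr.ok, Expr.ok_sub]
    · rw [unsortRound_run_of_notMem _ _ (by decide), a1]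
    · rw [unsortRound_run_of_notMem _ _ (by decide), a3]
    · rw [unsortRound_run_of_notMem _ _ (by decide), a2]
      omega

/-! ### The choice of parameters -/

/-- The block length, about `√(lg n / 2)`. -/
def blockLength (n : ℕ) : ℕ := Nat.sqrt (Nat.size n / 2 + 1)

/-- The parameters for `h` bit vectors of length `n`. -/
def params (n h : ℕ) : Params where
  n := n
  h := h
  b := blockLength n
  mu := 6 * Nat.size (blockLength n) + 2

theorem blockLength_pos (n : ℕ) : 0 < blockLength n := Nat.sqrt_pos.2 (by omega)

theorem size_lt (n : ℕ) : Nat.size n < 8 * blockLength n ^ 2 := by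
  have h1 := Nat.lt_succ_sqrt' (Nat.size n / 2 + 1)
  have h2 := blockLength_pos n
  change _ < (blockLength n + 1) ^ 2 at h1
  have : (blockLength n + 1) ^ 2 ≤ 4 * blockLength n ^ 2 := by nlinarith
  omega

theorem blockLength_sq_le (n : ℕ) : blockLength n ^ 2 ≤ Nat.size n / 2 + 1 := Nat.sqrt_le' _

theorem two_pow_size_le {n : ℕ} (hn : 1 ≤ n) : 2 ^ Nat.size n ≤ 2 * n := by
  have h1 : 0 < Nat.size n := Nat.size_pos.2 hn
  have h2 : 2 ^ (Nat.size n - 1) ≤ n := Nat.lt_size.1 (by omega)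
  have h3 : 2 ^ Nat.size n = 2 * 2 ^ (Nat.size n - 1) := by
    rw [← pow_succ', Nat.sub_add_cancel h1]
  omega

/-- The block length is chosen so that the number `2 ^ b ^ 2` of windows is `O(√n)`. -/
theorem two_pow_sq_mul_le {n : ℕ} (hn : 1 ≤ n) :
    2 ^ blockLength n ^ 2 * 2 ^ blockLength n ^ 2 ≤ 8 * n := by
  have h1 := blockLength_sq_le n
  calc 2 ^ blockLength n ^ 2 * 2 ^ blockLength n ^ 2 = 2 ^ (2 * blockLength n ^ 2) := by
        rw [two_mul, pow_add]
    _ ≤ 2 ^ (Nat.size n + 2) := Nat.pow_le_pow_right (by norm_num) (by omega)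
    _ = 4 * 2 ^ Nat.size n := by rw [pow_add]; ring
    _ ≤ 4 * (2 * n) := Nat.mul_le_mul_left _ (two_pow_size_le hn)
    _ = 8 * n := by ring

theorem valid_params {n h : ℕ} (hh : 0 < h) (hh' : h ≤ Nat.size n) :
    (params n h).Valid where
  b_pos := blockLength_pos n
  n_lt := (Nat.lt_size_self n).trans (Nat.pow_lt_pow_right (by norm_num) (size_lt n))
  h_pos := hh
  h_le := hh'.trans (size_lt n).le
  lt_mu := by
    have h1 : blockLength n < 2 ^ Nat.size (blockLength n) := Nat.lt_size_self _
    -- So `b ^ 6 < 2 ^ (6 * size b)`; the two extra bits in `mu` leave room for the `+ 1`.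
    have h2 := Nat.pow_lt_pow_left h1 (n := 6) (by norm_num)
    rw [← pow_mul'] at h2
    simp only [params, pow_add]
    omega
  mu_le := by
    have h1 : Nat.size (blockLength n) ≤ blockLength n := Nat.size_le.2 Nat.lt_two_pow_self
    have h2 := blockLength_pos n
    simp only [params]
    nlinarith

theorem Params.total_eq (p : Params) : p.total = 19 * p.lam + p.tab * p.mu +
    p.h * (p.n + 9 * p.n1 * p.lam + 3 * p.v1 * p.lam + 6 * p.n2 * p.mu + 3 * p.v2 * p.mu) := by
  simp only [total, oBits, oTable, oBlockValue, oBlock, oSuperValue, oSuper]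
  ring

/-- Only the header and the table are shared; charging them to every vector makes the redundancy a
function of `n` alone. -/
theorem total_params_le {n h : ℕ} (hh : 0 < h) : (params n h).total ≤ h * (params n 1).total := by
  rw [Params.total_eq, Params.total_eq, mul_add h, mul_add h]
  change _ + h * _ ≤ _ + h * (1 * _)
  rw [one_mul, ← mul_add h]
  exact Nat.add_le_add_right (Nat.le_mul_of_pos_left _ hh) _

/-- With `s = size b` and `u = 2 ^ b ^ 2`, the directories contribute `O(n * mu / b)`, which is `O(n
* s / 2 ^ s)` because `2 ^ s ≤ 2 * b`. Header, table and rounding terms are `O(u * b ^ 5)`, and `u *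
2 ^ b ≤ u * u ≤ 8 * n` turns this into `O(n * b ^ 5 / 2 ^ b)`. -/
theorem total_params_le_add {n : ℕ} (hn : 1 ≤ n) :
    ((params n 1).total : ℝ) ≤ n + n * (15552 *
      ((Nat.size (blockLength n) : ℝ) ^ 1 / 2 ^ Nat.size (blockLength n)) +
      20000 * ((blockLength n : ℝ) ^ 5 / 2 ^ blockLength n)) := by
  have hp := valid_params (n := n) one_pos (Nat.size_pos.2 hn)
  obtain ⟨s, hs⟩ : ∃ s, s = Nat.size (blockLength n) := ⟨_, rfl⟩
  have hmu : (params n 1).mu = 6 * s + 2 := by rw [hs]; rfl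
  have hmu' : (params n 1).mu ≤ 8 * blockLength n ^ 2 := hp.mu_le
  have hb := blockLength_pos n
  have hsb : 2 ^ s ≤ 2 * blockLength n := hs ▸ two_pow_size_le hb
  have hs1 : 1 ≤ s := hs ▸ Nat.size_pos.2 hb
  have hu := two_pow_sq_mul_le hn
  rw [← hs, Params.total_eq, hmu]
  rw [hmu] at hmu'
  change ((19 * (64 * blockLength n ^ 2) + 3 * 2 ^ blockLength n ^ 2 * blockLength n * (6 * s + 2) +
    1 * (n + 9 * (n / blockLength n ^ 3 + 1) * (64 * blockLength n ^ 2) +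
      3 * (((2 * n + blockLength n ^ 3) / blockLength n ^ 6 + 1) * blockLength n ^ 3) *
        (64 * blockLength n ^ 2) + 6 * (n / blockLength n + 1) * (6 * s + 2) +
      3 * (((2 * n + blockLength n ^ 3) / blockLength n ^ 2 + 1) * blockLength n) * (6 * s + 2)) :
        ℕ) : ℝ) ≤ _
  generalize blockLength n = b at *
  clear hp hs hmu
  have hbu : 2 ^ b ≤ 2 ^ b ^ 2 :=
    Nat.pow_le_pow_right (by norm_num) (Nat.le_self_pow (by norm_num) _)
  have c1 : ((n / b ^ 3 : ℕ) : ℝ) ≤ n / b ^ 3 := by exact_mod_cast Nat.cast_div_le (α := ℝ)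
  have c2 : (((2 * n + b ^ 3) / b ^ 6 : ℕ) : ℝ) ≤ (2 * n + b ^ 3) / b ^ 6 := by
    exact_mod_cast Nat.cast_div_le (α := ℝ) (m := 2 * n + b ^ 3) (n := b ^ 6)
  have c3 : ((n / b : ℕ) : ℝ) ≤ n / b := Nat.cast_div_le
  have c4 : (((2 * n + b ^ 3) / b ^ 2 : ℕ) : ℝ) ≤ (2 * n + b ^ 3) / b ^ 2 := by
    exact_mod_cast Nat.cast_div_le (α := ℝ) (m := 2 * n + b ^ 3) (n := b ^ 2)
  obtain ⟨u, hu'⟩ : ∃ u : ℕ, u = 2 ^ b ^ 2 := ⟨_, rfl⟩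
  rw [← hu'] at hu hbu
  push_cast
  have hu'' : (2 : ℝ) ^ b ^ 2 = u := by rw [hu']; push_cast; rfl
  rw [hu'']
  have b1 : (1 : ℝ) ≤ b := by exact_mod_cast hb
  have b0 : (0 : ℝ) < b := by linarith
  have s1 : (1 : ℝ) ≤ s := by exact_mod_cast hs1
  have n0 : (0 : ℝ) ≤ n := by positivity
  have u1 : (1 : ℝ) ≤ u := by exact_mod_cast (Nat.one_le_two_pow.trans hbu)
  obtain ⟨m, hm⟩ : ∃ m : ℝ, m = 6 * s + 2 := ⟨_, rfl⟩
  have hm8 : m ≤ 8 * s := by linarith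
  have hm1 : 1 ≤ m := by linarith
  have hmb : m ≤ 8 * (b : ℝ) ^ 2 := by rw [hm]; exact_mod_cast hmu'
  rw [← hm]
  have p2 : (b : ℝ) ^ 2 ≤ b ^ 5 := pow_le_pow_right₀ b1 (by norm_num)
  have p3 : (b : ℝ) ^ 3 ≤ b ^ 5 := pow_le_pow_right₀ b1 (by norm_num)
  have p4 : (b : ℝ) ^ 4 ≤ b ^ 5 := pow_le_pow_right₀ b1 (by norm_num)
  have p5 : (b : ℝ) ^ 5 ≤ u * b ^ 5 := le_mul_of_one_le_left (by positivity) u1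
  have q1 : (n : ℝ) / b ≤ n * m / b := by
    gcongr; exact le_mul_of_one_le_right n0 hm1
  -- the individual arrays
  have t1 : 9 * (((n / b ^ 3 : ℕ) : ℝ) + 1) * (64 * b ^ 2) ≤ 576 * (n * m / b) + 576 * (u * b ^ 5) :=
    calc _ ≤ 9 * ((n : ℝ) / b ^ 3 + 1) * (64 * b ^ 2) := by gcongr
      _ = 576 * (n / b) + 576 * b ^ 2 := by field_simp; ring
      _ ≤ _ := by linarith
  have t2 : 3 * ((((2 * n + b ^ 3) / b ^ 6 : ℕ) + 1) * (b : ℝ) ^ 3) * (64 * b ^ 2) ≤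
      384 * (n * m / b) + 384 * (u * b ^ 5) :=
    calc _ ≤ 3 * (((2 * n + (b : ℝ) ^ 3) / b ^ 6 + 1) * (b : ℝ) ^ 3) * (64 * b ^ 2) := by gcongr
      _ = 384 * (n / b) + 192 * b ^ 2 + 192 * b ^ 5 := by field_simp; ring
      _ ≤ _ := by linarith
  have t3 : 6 * (((n / b : ℕ) : ℝ) + 1) * m ≤ 6 * (n * m / b) + 48 * (u * b ^ 5) :=
    calc _ ≤ 6 * ((n : ℝ) / b + 1) * m := by gcongr
      _ = 6 * (n * m / b) + 6 * m := by field_simp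
      _ ≤ _ := by linarith
  have t4 : 3 * ((((2 * n + b ^ 3) / b ^ 2 : ℕ) + 1) * (b : ℝ)) * m ≤
      6 * (n * m / b) + 48 * (u * b ^ 5) :=
    calc _ ≤ 3 * (((2 * n + (b : ℝ) ^ 3) / b ^ 2 + 1) * (b : ℝ)) * m := by gcongr
      _ = 6 * (n * m / b) + (3 * b ^ 2 + 3 * b) * m := by field_simp; ring
      _ ≤ 6 * (n * m / b) + (3 * b ^ 2 + 3 * b) * (8 * (b : ℝ) ^ 2) := by gcongr
      _ = 6 * (n * m / b) + 24 * b ^ 4 + 24 * b ^ 3 := by ring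
      _ ≤ _ := by linarith
  have t5 : 3 * (u : ℝ) * b * m ≤ 24 * (u * b ^ 5) :=
    calc _ ≤ 3 * (u : ℝ) * b * (8 * b ^ 2) := by gcongr
      _ = 24 * (u * b ^ 3) := by ring
      _ ≤ _ := by gcongr
  have hfirst : n * m / b ≤ n * (16 * ((s : ℝ) ^ 1 / 2 ^ s)) := by
    have h1 : ((2 : ℝ) ^ s) ≤ 2 * b := by exact_mod_cast hsb
    rw [mul_div_assoc]
    gcongr
    rw [div_le_iff₀ b0, pow_one]
    calc m ≤ 8 * s := hm8
      _ = 16 * (s / 2 ^ s) * (2 ^ s / 2) := by field_simp; ring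
      _ ≤ 16 * (s / 2 ^ s) * b := by gcongr; linarith
  have hsecond : u * (b : ℝ) ^ 5 ≤ n * (8 * ((b : ℝ) ^ 5 / 2 ^ b)) := by
    have h1 : (u : ℝ) * u ≤ 8 * n := by exact_mod_cast hu
    have h2 : (2 : ℝ) ^ b ≤ u := by exact_mod_cast hbu
    have h3 : (u : ℝ) ≤ 8 * n / 2 ^ b := by
      rw [le_div_iff₀ (by positivity)]
      exact (by gcongr : (u : ℝ) * 2 ^ b ≤ u * u).trans h1
    calc u * (b : ℝ) ^ 5 ≤ 8 * n / 2 ^ b * b ^ 5 := by gcongr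
      _ = _ := by ring
  -- The constants are `972 * 16 = 15552` exactly and `2296 * 8 = 18368`, rounded up to `20000`;
  -- nonnegativity covers the slack.
  have hfinal := mul_nonneg n0 (show (0 : ℝ) ≤ (b : ℝ) ^ 5 / 2 ^ b by positivity)
  linarith

theorem tendsto_size : Filter.Tendsto Nat.size Filter.atTop Filter.atTop :=
  Filter.tendsto_atTop.2 fun B => by
    filter_upwards [Filter.eventually_ge_atTop (2 ^ B)] with n hn
    exact (Nat.lt_size.2 hn).le

theorem tendsto_blockLength : Filter.Tendsto blockLength Filter.atTop Filter.atTop :=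
  Filter.tendsto_atTop.2 fun B => by
    filter_upwards [Filter.eventually_ge_atTop (2 ^ (2 * B ^ 2))] with n hn
    refine Nat.le_sqrt'.2 ?_
    have := Nat.lt_size.2 hn
    omega

theorem tendsto_redundancy : Filter.Tendsto (fun n : ℕ => ((params n 1).total : ℝ) / n - 1)
    Filter.atTop (nhds 0) := by
  have h1 := ((tendsto_pow_const_div_const_pow_of_one_lt 1 (one_lt_two (α := ℝ))).comp
    (tendsto_size.comp tendsto_blockLength)).const_mul 15552
  have h2 := ((tendsto_pow_const_div_const_pow_of_one_lt 5 (one_lt_two (α := ℝ))).comp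
    tendsto_blockLength).const_mul 20000
  have h3 := h1.add h2
  rw [mul_zero, mul_zero, add_zero] at h3
  refine tendsto_of_tendsto_of_tendsto_of_le_of_le' tendsto_const_nhds h3 ?_ ?_
  · filter_upwards [Filter.eventually_ge_atTop 1] with n hn
    have hn' : (0 : ℝ) < n := by exact_mod_cast hn
    rw [sub_nonneg, one_le_div hn']
    exact_mod_cast (show n ≤ (params n 1).total by
      simp only [Params.total, params, one_mul]; omega)
  · filter_upwards [Filter.eventually_ge_atTop 1] with n hn
    have hn' : (0 : ℝ) < n := by exact_mod_cast hn
    rw [sub_le_iff_le_add, div_le_iff₀ hn']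
    refine (total_params_le_add hn).trans (le_of_eq ?_)
    simp only [Function.comp]
    ring

/-! ### The encoding of permutations -/

/-- The number of rounds of the radix sort. -/
noncomputable def numRounds {n : ℕ} (π : Equiv.Perm (Fin n)) : ℕ :=
  ⌈Real.logb 2 (numRuns π : ℝ)⌉₊

/-- The encoding of a permutation: nothing for the identity, and otherwise the bit vectors of the
radix sort of the values by run numbers. -/
noncomputable def encodePerm (n : ℕ) (π : Equiv.Perm (Fin n)) : List Bool :=
  if numRuns π = 1 then [] else
    (params n (numRounds π)).encoding (roundBits fun v : Fin n => runIndex π (π⁻¹ v))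

section Encode

variable {n : ℕ} (π : Equiv.Perm (Fin n))

theorem logb_numRuns_nonneg : 0 ≤ Real.logb 2 (numRuns π : ℝ) :=
  Real.logb_nonneg (by norm_num) (by exact_mod_cast Nat.succ_le_succ (Nat.zero_le _))

theorem numRuns_le_two_pow : numRuns π ≤ 2 ^ numRounds π := by
  have h0 : (0 : ℝ) < numRuns π := by exact_mod_cast Nat.succ_pos _
  have h : Real.logb 2 (numRuns π : ℝ) ≤ numRounds π := Nat.le_ceil _
  rw [Real.logb_le_iff_le_rpow (by norm_num) h0, Real.rpow_natCast] at h
  exact_mod_cast h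

theorem numRounds_le_size : numRounds π ≤ Nat.size n := by
  have h0 : (0 : ℝ) < numRuns π := by exact_mod_cast Nat.succ_pos _
  rw [numRounds, Nat.ceil_le, Real.logb_le_iff_le_rpow (by norm_num) h0, Real.rpow_natCast]
  have h1 : (downSteps π).card ≤ n := by
    simpa using Finset.card_le_univ (downSteps π)
  have h2 := Nat.lt_size_self n
  exact_mod_cast (show (downSteps π).card + 1 ≤ 2 ^ Nat.size n by omega)

theorem numRounds_pos (h : numRuns π ≠ 1) : 0 < numRounds π := by
  have h1 : 1 < numRuns π := lt_of_le_of_ne (Nat.succ_le_succ (Nat.zero_le _)) (Ne.symm h)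
  exact Nat.ceil_pos.2 (Real.logb_pos (by norm_num) (by exact_mod_cast h1))

theorem length_encodePerm_le (hn : 1 ≤ n) : ((encodePerm n π).length : ℝ) ≤
    n * (numRounds π : ℝ) * (1 + (((params n 1).total : ℝ) / n - 1)) := by
  have hn' : (0 : ℝ) < n := by exact_mod_cast hn
  have e : (n : ℝ) * (numRounds π : ℝ) * (1 + (((params n 1).total : ℝ) / n - 1)) =
      numRounds π * (params n 1).total := by field_simp; ring
  rw [e, encodePerm]
  split_ifs with h
  · simp only [List.length_nil, Nat.cast_zero]
    positivity
  · rw [Params.length_encoding]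
    exact_mod_cast total_params_le (numRounds_pos π h)

theorem logb_succ_ge_one (hn : 1 ≤ n) : 1 ≤ Real.logb 2 ((n : ℝ) + 1) := by
  rw [Real.le_logb_iff_rpow_le (by norm_num) (by positivity), Real.rpow_one]
  have : (1 : ℝ) ≤ n := by exact_mod_cast hn
  linarith

theorem lt_two_pow_of_logb_le {w : ℕ} (h : Real.logb 2 ((n : ℝ) + 1) ≤ w) : n < 2 ^ w := by
  rw [Real.logb_le_iff_le_rpow (by norm_num) (by positivity), Real.rpow_natCast] at h
  exact_mod_cast h

/-- With `L = lg (n + 1) ≥ 1`, the left side is `1024 * b ^ 2 ≤ 512 * (L + 3) ≤ 2048 * L`, below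
`3000 * L`. -/
theorem maxDeg_mul_lam_lt (hn : 1 ≤ n) {w : ℕ} (h : ℕ)
    (hw : 3000 * Real.logb 2 ((n : ℝ) + 1) ≤ w) : maxDeg * (params n h).lam < w := by
  have h1 := logb_succ_ge_one hn
  have h2 := blockLength_sq_le n
  have h3 : (Nat.size n : ℝ) ≤ Real.logb 2 ((n : ℝ) + 1) + 1 := by
    rw [← sub_le_iff_le_add, Real.le_logb_iff_rpow_le (by norm_num) (by positivity),
      Real.rpow_sub_one (by norm_num), Real.rpow_natCast, div_le_iff₀ (by norm_num)]
    have := two_pow_size_le hn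
    have : (2 : ℝ) ^ Nat.size n ≤ 2 * n := by exact_mod_cast this
    linarith
  have h4 : 2 * blockLength n ^ 2 ≤ Nat.size n + 2 := by omega
  have h5 : 2 * (blockLength n : ℝ) ^ 2 ≤ Nat.size n + 2 := by exact_mod_cast h4
  have h6 : ((maxDeg * (params n h).lam : ℕ) : ℝ) = 1024 * (blockLength n : ℝ) ^ 2 := by
    simp only [maxDeg, Params.lam, params]
    push_cast
    ring
  have h7 : ((maxDeg * (params n h).lam : ℕ) : ℝ) < w := by
    rw [h6]; linarith
  exact_mod_cast h7

theorem mainCost_le {h : ℕ} (body : Assignments) {L : ℝ} (hL : 0 ≤ L) (hh : (h : ℝ) ≤ L + 1) :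
    (mainCost body h : ℝ) ≤ mainCost body 1 * (1 + L) := by
  simp only [mainCost]
  push_cast
  have h1 : (h : ℝ) * (body.cost + 1) ≤ (L + 1) * (body.cost + 1) := by gcongr
  have h2 : 0 ≤ (12 + (prelude.cost : ℝ) + postlude.cost) * L := by positivity
  linarith

theorem numRounds_le : (numRounds π : ℝ) ≤ Real.logb 2 (numRuns π : ℝ) + 1 :=
  (Nat.ceil_lt_add_one (logb_numRuns_nonneg π)).le

theorem answersWithin_of_computes {w : ℕ} {bits : List Bool} {q : Program} {input output T : ℕ}
    {T' : ℝ} (h : Computes (dataWord w bits) q (State.init w input) T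
      fun s => (s.reg 0).toNat = output) (hT : (T : ℝ) ≤ T') :
    AnswersWithin w bits q input output T' := by
  obtain ⟨s, t, h1, h2, h3⟩ := h
  exact ⟨s, t, h1, h3, le_trans (by exact_mod_cast h2) hT⟩

theorem computes_of_numRuns_eq_one {w : ℕ} (h : numRuns π = 1) (i : Fin n) (hw : n < 2 ^ w)
    (body : Assignments) :
    Computes (dataWord w (encodePerm n π)) (mainCode body) (State.init w (i + 1))
      (mainCost body (numRounds π)) fun s => (s.reg 0).toNat = i + 1 := by
  rw [encodePerm, if_pos h]
  refine (computes_mainCode_nil body _).mono ?_ fun s hs => ?_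
  · rw [numRounds, h]; simp
  · rw [hs, BitVec.toNat_ofNat, Nat.mod_eq_of_lt (by omega)]

theorem computes_inverse (hn : 1 ≤ n) {w : ℕ} (hw : 3000 * Real.logb 2 ((n : ℝ) + 1) ≤ w)
    (v : Fin n) :
    Computes (dataWord w (encodePerm n π)) (mainCode sortBody) (State.init w (v + 1))
      (mainCost sortBody (numRounds π)) fun s => (s.reg 0).toNat = (π⁻¹ v : Fin n) + 1 := by
  by_cases h : numRuns π = 1
  · have h1 := logb_succ_ge_one hn
    have e : π⁻¹ v = v := by
      conv_lhs => rw [← apply_eq_of_numRuns_eq_one π h v, inv_apply_apply]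
    rw [e]
    exact computes_of_numRuns_eq_one π h v (lt_two_pow_of_logb_le (by linarith)) _
  · have hp := valid_params (numRounds_pos π h) (numRounds_le_size π)
    rw [encodePerm, if_neg h, ← pos_runIndex π (numRuns_le_two_pow π) v]
    exact computes_sort hp _ (maxDeg_mul_lam_lt hn _ hw) v

theorem computes_apply (hn : 1 ≤ n) {w : ℕ} (hw : 3000 * Real.logb 2 ((n : ℝ) + 1) ≤ w)
    (i : Fin n) :
    Computes (dataWord w (encodePerm n π)) (mainCode unsortBody) (State.init w (i + 1))
      (mainCost unsortBody (numRounds π)) fun s => (s.reg 0).toNat = (π i : Fin n) + 1 := by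
  by_cases h : numRuns π = 1
  · have h1 := logb_succ_ge_one hn
    rw [apply_eq_of_numRuns_eq_one π h i]
    exact computes_of_numRuns_eq_one π h i (lt_two_pow_of_logb_le (by linarith)) _
  · have hp := valid_params (numRounds_pos π h) (numRounds_le_size π)
    have e := pos_runIndex π (numRuns_le_two_pow π) (π i)
    rw [inv_apply_apply] at e
    rw [encodePerm, if_neg h, ← e]
    exact computes_unsort hp _ (maxDeg_mul_lam_lt hn _ hw) (π i)

end Encode

end SuccinctPerm

theorem mainTheorem11 :
    ∃ (encode : (n : ℕ) → Equiv.Perm (Fin n) → List Bool)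
      (applyProg inverseProg : Program) (ε : ℕ → ℝ) (B C c : ℝ),
      Filter.Tendsto ε Filter.atTop (nhds 0) ∧
      ∀ (n : ℕ), 1 ≤ n → ∀ (π : Equiv.Perm (Fin n)),
        ((encode n π).length : ℝ) ≤
            (n : ℝ) * (⌈Real.logb 2 (numRuns π : ℝ)⌉₊ : ℝ) * (1 + ε n)
              + B * Real.logb 2 ((n : ℝ) + 1) ∧
        ∀ (w : ℕ), c * Real.logb 2 ((n : ℝ) + 1) ≤ (w : ℝ) → ∀ (i : Fin n),
          AnswersWithin w (encode n π) applyProg ((i : ℕ) + 1) ((π i : ℕ) + 1)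
            (C * (1 + Real.logb 2 (numRuns π : ℝ))) ∧
          AnswersWithin w (encode n π) inverseProg ((i : ℕ) + 1) ((π⁻¹ i : ℕ) + 1)
            (C * (1 + Real.logb 2 (numRuns π : ℝ))) := by
  -- The additive term is not needed (`B = 0`): the identity has an empty encoding, and otherwise `h
  -- ≥ 1` rounds absorb the header and the table.
  refine ⟨encodePerm, mainCode unsortBody, mainCode sortBody,
    fun n => ((params n 1).total : ℝ) / n - 1, 0, mainCost unsortBody 1 + mainCost sortBody 1, 3000,
    tendsto_redundancy, fun n hn π => ⟨?_, fun w hw i => ⟨?_, ?_⟩⟩⟩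
  · rw [zero_mul, add_zero]
    exact length_encodePerm_le π hn
  · refine answersWithin_of_computes (computes_apply π hn hw i)
      ((mainCost_le _ (logb_numRuns_nonneg π) (numRounds_le π)).trans ?_)
    have := logb_numRuns_nonneg π
    gcongr
    exact le_add_of_nonneg_right (Nat.cast_nonneg _)
  · refine answersWithin_of_computes (computes_inverse π hn hw i)
      ((mainCost_le _ (logb_numRuns_nonneg π) (numRounds_le π)).trans ?_)
    have := logb_numRuns_nonneg π
    gcongr
    exact le_add_of_nonneg_left (Nat.cast_nonneg _)
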